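/- **Corollary (Eigenstate property estimation).** Let $H$ be a Hamiltonian on $n$ qubits with eigenvalues $E_0\le E_1\le\dots\le E_{2^n-1}$ (with multiplicity) and a corresponding orthonormal eigenbasis, let $|E_j\rangle$ be an eigenvector with positive energy gap $\Delta_j:=\min(E_{j+1}-E_j,\;E_j-E_{j-1})>0$ (at an end of the spectrum only the existing neighbour counts), and let $|\psi_0\rangle$ be a unit vector with $|\langle E_j|\psi_0\rangle|^2\ge\eta>0$. Let $P$ be a probability distribution of random unitaries $R\in U(2^n)$ that is tomographically complete, i.e. the map $\mathcal M(X)=\mathbb E_{R}\sum_{z\in\{0,1\}^n}\langle z|RXR^\dagger|z\rangle\,R^\dagger|z\rangle\langle z|R$ is invertible, and let $$\|O\|_{\rm shadow}^2=\sup_{\sigma}\ \mathbb E_{R}\sum_{z}\langle z|R\sigma R^\dagger|z\rangle\,\langle z|R\,\mathcal M^{-1}(O)R^\dagger|z\rangle^2 ,$$ the supremum being over all density operators $\sigma$. *Protocol.* For $\tau,T>0$ one measurement consists of the following. Draw independently two times $t_1,t_2$ from the centred Gaussian of variance $2\tau^2$ conditioned on $|t|\le T$ (without the conditioning, $\mathbb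 E\,e^{-it(H-E_j)}=e^{-\tau^2(H-E_j)^2}$), so that $T$ is the maximum evolution time. With $\tilde U(t)=e^{itE_j}e^{-itH}$, run on $\rho=|\psi_0\rangle\langle\psi_0|$ the Hadamard-test circuit with Kraus operators $K_a=\tfrac12\big((-1)^a\tilde U(t_1)+\tilde U(t_2)\big)$, $a\in\{0,1\}$ being the ancilla outcome. Apply a random $R\sim P$ to the system and measure it in the computational basis with outcome $z$; the pair $(a,z)$ has probability $\langle z|RK_a\rho K_a^\dagger R^\dagger|z\rangle$. Set $\hat v=(-1)^a\mathcal M^{-1}(R^\dagger|z\rangle\langle z|R)$. From $K\cdot L$ independent measurements, split into $K$ batches of $L$, let $\widehat{\operatorname{mom}}(O)$ be the median over the batches of the batch means of $\operatorname{tr}(O\hat v)$, and estimate $\langle E_j|O|E_j\rangle$ by $\hat o=\widehat{\operatorname{mom}}(O)/\widehat{\operatorname{mom}}(I)$ (with the conventions $x/0=0$ and $\widehat{\operatorname{mom}}=0$ if no measurement is made). *Claim.* For every $\eta>0$ there is a constant $C_N>0$, and for every $B>0$ a constant $C_T>0$ (depending only on $\eta$ and $B$), such that for all $n$, all tomographically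 complete $P$, all Hermitian observables $O_1,\dots,O_M$ ($M\ge1$) of operator norm at most $B$, and all $\varepsilon,\delta\in(0,\tfrac12]$ the following holds. There are $K,L$ with number of measurements $$K L\ \le\ C_N\,\varepsilon^{-2}\,\max_m\|O_m\|_{\rm shadow}^2\,\log(M/\delta),$$ and for every $\Delta>0$ there are $\tau>0$ and a maximum evolution time $$0<T\ \le\ C_T\,\Delta^{-1}\log(1/\varepsilon),$$ such that for all $H$, $j$ with $\Delta_j=\Delta$, and all $|\psi_0\rangle$ as above, with probability at least $1-\delta$ the estimates satisfy $|\hat o_m-\langle E_j|O_m|E_j\rangle|\le\varepsilon$ simultaneously for all $m=1,\dots,M$. -/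

import Mathlib

open scoped ComplexOrder

noncomputable section

/-- `n`-bit strings, labelling the computational basis of `n` qubits. -/
abbrev Bits (n : ℕ) := Fin n → Bool

/-- Operators on `n` qubits. -/
abbrev Op (n : ℕ) := Matrix (Bits n) (Bits n) ℂ

/-- State vectors of `n` qubits. -/
abbrev Ket (n : ℕ) := EuclideanSpace ℂ (Bits n)

/-- The unitary group `U(2^n)`. -/
abbrev QUnitary (n : ℕ) := Matrix.unitaryGroup (Bits n) ℂ

/-- The Borel `σ`-algebra on `U(2^n)`. -/
instance qUnitaryMeasurableSpace (n : ℕ) : MeasurableSpace (QUnitary n) := borel _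

instance qUnitaryBorelSpace (n : ℕ) : BorelSpace (QUnitary n) := ⟨rfl⟩

/-- The projector `|ψ⟩⟨ψ|`. -/
def pureState {n : ℕ} (ψ : Ket n) : Op n :=
  Matrix.vecMulVec ψ.ofLp (star ψ.ofLp)

/-- Density operators. -/
def IsDensity {n : ℕ} (σ : Op n) : Prop := σ.PosSemidef ∧ σ.trace = 1

/-- The expectation value `⟨ψ|O|ψ⟩` of an observable. -/
def expectation {n : ℕ} (O : Op n) (ψ : Ket n) : ℝ :=
  (inner ℂ ψ (Matrix.toEuclideanLin O ψ)).re

/-! ### Hamiltonians, eigenstates, gaps -/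

/-- `E 0 ≤ E 1 ≤ …` are the eigenvalues of `H`, with multiplicity, and `b` is an orthonormal basis
of corresponding eigenvectors. -/
structure IsSortedEigenbasis {n : ℕ} (H : Op n) (E : Fin (2 ^ n) → ℝ)
    (b : OrthonormalBasis (Fin (2 ^ n)) ℂ (Ket n)) : Prop where
  sorted : Monotone E
  eigen : ∀ k, Matrix.toEuclideanLin H (b k) = (E k : ℂ) • b k

/-- The gap `min (E_{j+1} - E_j) (E_j - E_{j-1})`; at the two ends of the spectrum only the
neighbour that exists counts. -/
def energyGap {d : ℕ} (E : Fin d → ℝ) (j : Fin d) : ℝ :=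
  ⨅ k : {k : Fin d // k.val = j.val + 1 ∨ k.val + 1 = j.val}, |E k - E j|

/-- `e^{i t ω} e^{-i t H}`: time evolution for the time `t`, with the phase of the filter
centre `ω` absorbed. -/
def phasedEvolution {n : ℕ} (H : Op n) (ω t : ℝ) : Op n :=
  Complex.exp ((t * ω : ℝ) * Complex.I) • NormedSpace.exp ((-(t : ℂ) * Complex.I) • H)

/-- The distribution of one evolution time.  The spectral filter is
`e^{-τ²(H-ω)²} = 𝔼 [e^{-i t (H-ω)}]` with `t` a centred Gaussian of variance `2 τ²`; times are
drawn from this Gaussian conditioned on `|t| ≤ T`. -/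
def timeLaw (τ T : ℝ) : MeasureTheory.Measure ℝ :=
  ProbabilityTheory.cond (ProbabilityTheory.gaussianReal 0 (Real.toNNReal (2 * τ ^ 2)))
    (Set.Icc (-T) T)

/-! ### Classical shadows -/

/-- `R X R†`. -/
def rotated {n : ℕ} (R : QUnitary n) (X : Op n) : Op n :=
  (R : Op n) * X * (R : Op n).conjTranspose

/-- `R† |z⟩⟨z| R`. -/
def rawSnapshot {n : ℕ} (R : QUnitary n) (z : Bits n) : Op n :=
  (R : Op n).conjTranspose * Matrix.single z z 1 * (R : Op n)

/-- The measurement channel `ℳ(X) = 𝔼_R ∑_z ⟨z|R X R†|z⟩ R†|z⟩⟨z|R` of a random unitary with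
law `P` (the integral is taken entry by entry). -/
def shadowChannel {n : ℕ} (P : MeasureTheory.Measure (QUnitary n)) (X : Op n) : Op n :=
  Matrix.of fun v w => ∫ R, ∑ z, rotated R X z z * rawSnapshot R z v w ∂P

/-- The ensemble is tomographically complete: `ℳ` is invertible. -/
def TomographicallyComplete {n : ℕ} (P : MeasureTheory.Measure (QUnitary n)) : Prop :=
  Function.Bijective (shadowChannel P)

/-- `ℳ⁻¹`. -/
def shadowInverse {n : ℕ} (P : MeasureTheory.Measure (QUnitary n)) : Op n → Op n :=
  Function.invFun (shadowChannel P)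

/-- The shadow norm: `‖O‖² = sup_σ 𝔼_R ∑_z ⟨z|RσR†|z⟩ ⟨z|R ℳ⁻¹(O) R†|z⟩²`, over states `σ`. -/
def shadowNorm {n : ℕ} (P : MeasureTheory.Measure (QUnitary n)) (O : Op n) : ℝ :=
  Real.sqrt (⨆ σ : {σ : Op n // IsDensity σ},
    ∫ R, ∑ z, (rotated R σ.1 z z).re * (rotated R (shadowInverse P O) z z).re ^ 2 ∂P)

/-! ### The randomised measurement protocol -/

/-- The sign `(-1)^a`. -/
def outcomeSign (a : Bool) : ℝ := if a then -1 else 1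

/-- The Kraus operator `½ ((-1)^a U + V)` of the Hadamard-test circuit: ancilla in `|+⟩`,
controlled `V` (on `|0⟩`) and `U` (on `|1⟩`), `X` measurement of the ancilla with outcome `a`. -/
def hadamardKraus {n : ℕ} (U V : Op n) (a : Bool) : Op n :=
  (1 / 2 : ℂ) • ((outcomeSign a : ℂ) • U + V)

/-- The random quantities of one run of the circuit: the two evolution times, the random
unitary, the ancilla outcome, and the outcome of the final measurement of the `n` qubits. -/
abbrev Shot (n : ℕ) := (ℝ × ℝ) × QUnitary n × Bool × Bits n

/-- Given the times and `R`, the joint probability `⟨z|R K_a ρ K_a† R†|z⟩` of the outcomes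
`a` and `z`, i.e. the probability of `a` times that of `z` given the state conditioned on `a`. -/
def outcomeProb {n : ℕ} (H : Op n) (ω : ℝ) (ψ : Ket n) (s : Shot n) : ℝ :=
  let K := hadamardKraus (phasedEvolution H ω s.1.1) (phasedEvolution H ω s.1.2) s.2.2.1
  (rotated s.2.1 (K * pureState ψ * K.conjTranspose) s.2.2.2 s.2.2.2).re

/-- The law of one run: independent times from `timeLaw τ T`, an independent `R` of law `P`,
and then outcomes `(a, z)` distributed by the Born rule. -/
def shotLaw {n : ℕ} (P : MeasureTheory.Measure (QUnitary n)) (H : Op n) (ω τ T : ℝ) (ψ : Ket n) :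
    MeasureTheory.Measure (Shot n) :=
  (((timeLaw τ T).prod (timeLaw τ T)).prod
    (P.prod ((MeasureTheory.Measure.count : MeasureTheory.Measure Bool).prod
      (MeasureTheory.Measure.count : MeasureTheory.Measure (Bits n))))).withDensity
    fun s => ENNReal.ofReal (outcomeProb H ω ψ s)

/-- The estimator `v̂ = (-1)^a ℳ⁻¹(R†|z⟩⟨z|R)` of the unnormalised filtered state. -/
def stateEstimator {n : ℕ} (P : MeasureTheory.Measure (QUnitary n)) (s : Shot n) : Op n :=
  (outcomeSign s.2.2.1 : ℂ) • shadowInverse P (rawSnapshot s.2.1 s.2.2.2)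

/-- `ô = tr (O v̂)`. -/
def shotEstimate {n : ℕ} (P : MeasureTheory.Measure (QUnitary n)) (O : Op n) (s : Shot n) : ℝ :=
  (O * stateEstimator P s).trace.re

/-- The median of `K` reals (the mean of the two middle values if `K` is even; `0` if `K = 0`). -/
def median {K : ℕ} (x : Fin K → ℝ) : ℝ :=
  let l := (Finset.univ.val.map x).sort (· ≤ ·)
  (l.getD ((K - 1) / 2) 0 + l.getD (K / 2) 0) / 2

/-- Median over `K` batches of the means of `tr (O v̂)` over batches of `L` runs. -/
def medianOfMeans {n K L : ℕ} (P : MeasureTheory.Measure (QUnitary n)) (O : Op n)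
    (data : Fin K × Fin L → Shot n) : ℝ :=
  median fun k : Fin K => (∑ l : Fin L, shotEstimate P O (data (k, l))) / L

/-- The estimate of `⟨O⟩ = tr (O |φ⟩⟨φ|) / tr |φ⟩⟨φ|`, numerator and denominator both estimated
from the same data. -/
def eigenstateEstimate {n K L : ℕ} (P : MeasureTheory.Measure (QUnitary n)) (O : Op n)
    (data : Fin K × Fin L → Shot n) : ℝ :=
  medianOfMeans P O data / medianOfMeans P 1 data

end

open scoped ENNReal
open MeasureTheory ProbabilityTheory

/-! ### Medians and medians of means -/

/-! Weighting the two ancilla outcomes by `(-1)^a` cancels the diagonal terms of the Hadamard test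
and leaves the cross terms between the states evolved for `t₁` and `t₂`. As the times are
independent, the average over them factorises, so one shot is an unbiased estimate of `⟨φ|O|φ⟩`,
where `φ` is the evolved state averaged over one time (`integral_shotEstimate`). In the eigenbasis,
averaging multiplies each coefficient by the characteristic function of the truncated Gaussian:
exactly 1 at `E j`, and at most some small `e` at distance `≥ Δ`. Hence `φ = c • b j + r` with `r ⟂
b j` and `‖r‖ ≤ e` (`exists_filtered_eq`). With `p = ‖c‖²`, the numerator is `p⟨O⟩` up to `3Be` and
the denominator is `p` up to `e²`. A time `T` of order `Δ⁻¹ log(1/ε)` makes `e` of order `ε`.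

The sign disappears on squaring, so the second moment is an average over unit states and is at most
the squared shadow norm (`integral_shotEstimate_sq_le`). For the identity the estimator is `±1`. Let
`s` be the largest shadow norm. Since `|⟨O⟩| ≤ s` (`abs_expectation_le_shadowNorm`), the quotient
tolerates a numerator error of order `ηε` and a denominator error of order `ηε/s`. Chebyshev's
inequality asks for the same batch length `L ~ s²/(ηε)²` in both cases, which keeps the number of
measurements free of `B`. Medians of `K ~ log(M/δ)` batches and a union bound over the `M`
numerators and the common denominator finish the argument (`measure_medianOfMeans_dev_le`,
`abs_div_sub_le`).

If `s ≤ ε` the allowed number of measurements may be below one; then none is made, and the default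
estimate 0 is already accurate. -/

theorem median_lt_of_card {K : ℕ} (x : Fin K → ℝ) (hi : ℝ)
    (h : 2 * (Finset.univ.filter fun k => hi ≤ x k).card < K) : median x < hi := by
  set l := (Finset.univ.val.map x).sort (· ≤ ·) with hl
  have hlen : l.length = K := by simp [hl]
  have hpw : l.Pairwise (· ≤ ·) := Multiset.pairwise_sort _ _
  have hcount : l.countP (fun y => decide (hi ≤ y))
      = (Finset.univ.filter fun k => hi ≤ x k).card := by
    have h1 : (l : Multiset ℝ) = Finset.univ.val.map x := Multiset.sort_eq _ _
    have h2 : Multiset.countP (fun y => hi ≤ y) (l : Multiset ℝ)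
        = Multiset.countP (fun y => hi ≤ y) (Finset.univ.val.map x) := by rw [h1]
    rw [Multiset.coe_countP, Multiset.countP_map] at h2
    rw [h2]
    rfl
  -- Were a sorted entry at or before `K / 2` at least `hi`, so would be all entries after it, which
  -- is at least half of them. Both middle positions are covered.
  have key : ∀ i, i ≤ K / 2 → i < K → l.getD i 0 < hi := by
    intro i hi2 hiK
    have hi' : i < l.length := by omega
    by_contra! hcon
    rw [List.getD_eq_getElem _ _ hi'] at hcon
    have hall : ∀ y ∈ l.drop i, decide (hi ≤ y) = true := by
      intro y hy
      obtain ⟨j, hj, rfl⟩ := List.mem_iff_getElem.1 hy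
      rw [List.getElem_drop]
      simp only [decide_eq_true_eq]
      rw [List.length_drop] at hj
      rcases Nat.eq_zero_or_pos j with h0 | h0
      · subst h0; simpa using hcon
      · exact hcon.trans (List.pairwise_iff_getElem.1 hpw i (i + j) hi' (by omega) (by omega))
    have h3 : (l.drop i).countP (fun y => decide (hi ≤ y)) = (l.drop i).length :=
      List.countP_eq_length.2 hall
    have h4 : (l.drop i).countP (fun y => decide (hi ≤ y))
        ≤ l.countP (fun y => decide (hi ≤ y)) := (List.drop_sublist i l).countP_le
    rw [List.length_drop] at h3
    omega
  have hK : 0 < K := by omega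
  have h1 := key ((K - 1) / 2) (by omega) (by omega)
  have h2 := key (K / 2) le_rfl (by omega)
  change (l.getD ((K - 1) / 2) 0 + l.getD (K / 2) 0) / 2 < hi
  linarith

theorem lt_median_of_card {K : ℕ} (x : Fin K → ℝ) (lo : ℝ)
    (h : 2 * (Finset.univ.filter fun k => x k ≤ lo).card < K) : lo < median x := by
  set l := (Finset.univ.val.map x).sort (· ≤ ·) with hl
  have hlen : l.length = K := by simp [hl]
  have hpw : l.Pairwise (· ≤ ·) := Multiset.pairwise_sort _ _
  have hcount : l.countP (fun y => decide (y ≤ lo))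
      = (Finset.univ.filter fun k => x k ≤ lo).card := by
    have h1 : (l : Multiset ℝ) = Finset.univ.val.map x := Multiset.sort_eq _ _
    have h2 : Multiset.countP (fun y => y ≤ lo) (l : Multiset ℝ)
        = Multiset.countP (fun y => y ≤ lo) (Finset.univ.val.map x) := by rw [h1]
    rw [Multiset.coe_countP, Multiset.countP_map] at h2
    rw [h2]
    rfl
  have key : ∀ i, (K - 1) / 2 ≤ i → i < K → lo < l.getD i 0 := by
    intro i hi2 hiK
    have hi' : i < l.length := by omega
    by_contra! hcon
    rw [List.getD_eq_getElem _ _ hi'] at hcon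
    have hall : ∀ y ∈ l.take (i + 1), decide (y ≤ lo) = true := by
      intro y hy
      obtain ⟨j, hj, rfl⟩ := List.mem_iff_getElem.1 hy
      rw [List.getElem_take]
      simp only [decide_eq_true_eq]
      rw [List.length_take] at hj
      rcases Nat.lt_or_ge j i with h0 | h0
      · exact (List.pairwise_iff_getElem.1 hpw j i (by omega) hi' h0).trans hcon
      · obtain rfl : j = i := by omega
        exact hcon
    have h3 : (l.take (i + 1)).countP (fun y => decide (y ≤ lo)) = (l.take (i + 1)).length :=
      List.countP_eq_length.2 hall
    have h4 : (l.take (i + 1)).countP (fun y => decide (y ≤ lo))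
        ≤ l.countP (fun y => decide (y ≤ lo)) := (List.take_sublist (i + 1) l).countP_le
    rw [List.length_take] at h3
    omega
  have hK : 0 < K := by omega
  have h1 := key ((K - 1) / 2) (by omega) (by omega)
  have h2 := key (K / 2) (by omega) (by omega)
  change lo < (l.getD ((K - 1) / 2) 0 + l.getD (K / 2) 0) / 2
  linarith

theorem abs_median_sub_lt {K : ℕ} (x : Fin K → ℝ) (a c : ℝ)
    (h : 2 * (Finset.univ.filter fun k => c ≤ |x k - a|).card < K) : |median x - a| < c := by
  rw [abs_sub_lt_iff]
  constructor
  · have := median_lt_of_card x (a + c) (lt_of_le_of_lt (by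
      refine Nat.mul_le_mul_left 2 (Finset.card_le_card fun k => ?_)
      simp only [Finset.mem_filter, Finset.mem_univ, true_and]
      intro hk
      exact le_abs.2 (Or.inl (by linarith))) h)
    linarith
  · have := lt_median_of_card x (a - c) (lt_of_le_of_lt (by
      refine Nat.mul_le_mul_left 2 (Finset.card_le_card fun k => ?_)
      simp only [Finset.mem_filter, Finset.mem_univ, true_and]
      intro hk
      exact le_abs.2 (Or.inr (by linarith))) h)
    linarith

/-- Lets the data indexed by pairs be read as independent batches of independent shots. -/
theorem map_uncurry_pi {ι κ Ω : Type*} [Fintype ι] [Fintype κ] [MeasurableSpace Ω]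
    (μ : Measure Ω) [IsProbabilityMeasure μ] :
    (Measure.pi fun _ : ι => Measure.pi fun _ : κ => μ).map (fun x (p : ι × κ) => x p.1 p.2)
      = Measure.pi fun _ : ι × κ => μ := by
  refine (Measure.pi_eq fun s hs => ?_).symm
  rw [Measure.map_apply (by fun_prop) (MeasurableSet.univ_pi hs)]
  have : (fun (x : ι → κ → Ω) (p : ι × κ) => x p.1 p.2) ⁻¹' (Set.univ.pi s)
      = Set.univ.pi fun i => Set.univ.pi fun k => s (i, k) := by
    ext x; simp
  rw [this, Measure.pi_pi]
  simp_rw [Measure.pi_pi]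
  rw [Fintype.prod_prod_type]

theorem pi_prod_forall_mem {ι κ Ω : Type*} [Fintype ι] [Fintype κ] [MeasurableSpace Ω]
    (μ : Measure Ω) [IsProbabilityMeasure μ] {D : Set (κ → Ω)} (hD : MeasurableSet D)
    (S : Finset ι) :
    Measure.pi (fun _ : ι × κ => μ) {data | ∀ i ∈ S, (fun k => data (i, k)) ∈ D}
      = Measure.pi (fun _ : κ => μ) D ^ S.card := by
  classical
  have hm : MeasurableSet {data : ι × κ → Ω | ∀ i ∈ S, (fun k => data (i, k)) ∈ D} := by
    have : {data : ι × κ → Ω | ∀ i ∈ S, (fun k => data (i, k)) ∈ D}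
        = ⋂ i ∈ S, (fun (data : ι × κ → Ω) k => data (i, k)) ⁻¹' D := by ext; simp
    rw [this]
    exact Finset.measurableSet_biInter _ fun i _ => hD.preimage (by fun_prop)
  rw [← map_uncurry_pi μ, Measure.map_apply (by fun_prop) hm]
  have : (fun (x : ι → κ → Ω) (p : ι × κ) => x p.1 p.2) ⁻¹'
      {data | ∀ i ∈ S, (fun k => data (i, k)) ∈ D}
      = Set.univ.pi fun i => if i ∈ S then D else Set.univ := by
    ext x
    simp only [Set.mem_preimage, Set.mem_ofPred_eq, Set.mem_univ_pi]
    refine forall_congr' fun i => ?_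
    by_cases hi : i ∈ S <;> simp [hi]
  rw [this, Measure.pi_pi]
  rw [← Finset.prod_subset (Finset.subset_univ S)]
  · rw [Finset.prod_congr rfl (g := fun _ => Measure.pi (fun _ : κ => μ) D), Finset.prod_const]
    intro i hi; simp [hi]
  · intro i _ hi; simp [hi]

/-- Amplification by the median: if a batch statistic deviates with probability at most `1/16`,
the median over `K` batches deviates with probability at most `2⁻ᴷ`. -/
theorem measure_median_dev_le {K : ℕ} {κ Ω : Type*} [Fintype κ] [MeasurableSpace Ω]
    (μ : Measure Ω) [IsProbabilityMeasure μ] {f : (κ → Ω) → ℝ} (hf : Measurable f) (a c : ℝ)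
    (h : Measure.pi (fun _ : κ => μ) {x | c ≤ |f x - a|} ≤ 16⁻¹) :
    Measure.pi (fun _ : Fin K × κ => μ)
      {data | c ≤ |median (fun k => f fun l => data (k, l)) - a|} ≤ 2⁻¹ ^ K := by
  have hD : MeasurableSet {x | c ≤ |f x - a|} :=
    measurableSet_le measurable_const (hf.sub_const a).abs
  set D := {x | c ≤ |f x - a|} with hDdef
  -- A deviating median forces some set of at least half the batches to deviate. There are at most
  -- `2 ^ K` such sets, each of probability at most `16^(-K/2) = 4^(-K)`.
  let 𝒮 := (Finset.univ : Finset (Finset (Fin K))).filter fun S => K ≤ 2 * S.card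
  have hsub : {data : Fin K × κ → Ω | c ≤ |median (fun k => f fun l => data (k, l)) - a|}
      ⊆ ⋃ S ∈ 𝒮, {data | ∀ i ∈ S, (fun k => data (i, k)) ∈ D} := by
    intro data hdata
    simp only [Set.mem_iUnion]
    refine ⟨Finset.univ.filter fun k => c ≤ |f (fun l => data (k, l)) - a|, ?_, ?_⟩
    · simp only [𝒮, Finset.mem_filter, Finset.mem_univ, true_and]
      by_contra! hcon
      exact absurd (abs_median_sub_lt _ a c hcon) (not_lt.2 hdata)
    · intro i hi
      exact (Finset.mem_filter.1 hi).2
  calc _ ≤ _ := measure_mono hsub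
    _ ≤ ∑ S ∈ 𝒮, Measure.pi (fun _ : Fin K × κ => μ)
          {data | ∀ i ∈ S, (fun k => data (i, k)) ∈ D} := measure_biUnion_finset_le _ _
    _ ≤ ∑ S ∈ 𝒮, (4⁻¹ : ℝ≥0∞) ^ K := by
        refine Finset.sum_le_sum fun S hS => ?_
        rw [pi_prod_forall_mem μ hD]
        have hS' : K ≤ 2 * S.card := by simpa [𝒮] using hS
        calc Measure.pi (fun _ : κ => μ) D ^ S.card ≤ (16⁻¹ : ℝ≥0∞) ^ S.card := by gcongr
          _ = (4⁻¹ : ℝ≥0∞) ^ (2 * S.card) := by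
              rw [pow_mul, show (16 : ℝ≥0∞) = 4 ^ 2 by norm_num, ENNReal.inv_pow]
          _ ≤ 4⁻¹ ^ K := pow_le_pow_of_le_one (by positivity) (by simp) hS'
    _ ≤ 2 ^ K * (4⁻¹ : ℝ≥0∞) ^ K := by
        rw [Finset.sum_const, nsmul_eq_mul]
        gcongr
        have : 𝒮.card ≤ 2 ^ K := by
          refine (Finset.card_le_univ _).trans ?_
          simp
        exact_mod_cast this
    _ = 2⁻¹ ^ K := by
        rw [← mul_pow]
        congr 1
        rw [show (4 : ℝ≥0∞) = 2 * 2 by norm_num, ENNReal.mul_inv (by simp) (by simp), ← mul_assoc,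
          ENNReal.mul_inv_cancel (by simp) (by simp), one_mul]

/-- Chebyshev's inequality for the mean of `L` independent samples. -/
theorem measure_mean_dev_le {L : ℕ} {Ω : Type*} [MeasurableSpace Ω]
    (μ : Measure Ω) [IsProbabilityMeasure μ] {X : Ω → ℝ} (hX : MemLp X 2 μ) {V c : ℝ} (hc : 0 < c)
    (hV : ∫ ω, X ω ^ 2 ∂μ ≤ V) (hL : 0 < L) (hLc : 16 * V ≤ L * c ^ 2) :
    Measure.pi (fun _ : Fin L => μ) {x | c ≤ |(∑ l, X (x l)) / L - ∫ ω, X ω ∂μ|} ≤ 16⁻¹ := by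
  have hL' : (0 : ℝ) < L := by exact_mod_cast hL
  set Y : (Fin L → Ω) → ℝ := ∑ l, fun x => X (x l) with hY
  have hYm : MemLp Y 2 (Measure.pi fun _ : Fin L => μ) :=
    memLp_finsetSum' _ fun l _ => hX.comp_measurePreserving (measurePreserving_eval _ l)
  have hYvar : Var[Y; Measure.pi fun _ : Fin L => μ] = L * Var[X; μ] := by
    rw [hY, variance_sum_pi (X := fun _ => X) fun _ => hX]; simp
  have hYint : ∫ x, Y x ∂(Measure.pi fun _ : Fin L => μ) = L * ∫ ω, X ω ∂μ := by
    simp only [hY, Finset.sum_apply]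
    rw [integral_finsetSum]
    · rw [Finset.sum_congr rfl (g := fun _ => ∫ ω, X ω ∂μ)]
      · simp
      · intro l _
        exact integral_comp_eval (μ := fun _ : Fin L => μ) (i := l) (f := X)
          hX.aestronglyMeasurable
    · intro l _
      exact (hX.comp_measurePreserving
        (measurePreserving_eval (fun _ : Fin L => μ) l)).integrable (by norm_num)
  have hcheb := meas_ge_le_variance_div_sq hYm (c := L * c) (by positivity)
  have hset : {x : Fin L → Ω | c ≤ |(∑ l, X (x l)) / L - ∫ ω, X ω ∂μ|}
      = {x | L * c ≤ |Y x - ∫ x, Y x ∂(Measure.pi fun _ : Fin L => μ)|} := by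
    ext x
    simp only [Set.mem_ofPred_eq]
    have : Y x - ∫ x, Y x ∂(Measure.pi fun _ : Fin L => μ)
        = L * ((∑ l, X (x l)) / L - ∫ ω, X ω ∂μ) := by
      rw [hYint, hY, Finset.sum_apply]; field_simp
    rw [this, abs_mul, abs_of_pos hL', mul_le_mul_iff_right₀ hL']
  rw [hset]
  refine hcheb.trans ?_
  have hvarX : Var[X; μ] ≤ V := (variance_le_expectation_sq hX.aestronglyMeasurable).trans hV
  have : Var[Y; Measure.pi fun _ : Fin L => μ] / (L * c) ^ 2 ≤ 16⁻¹ := by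
    rw [hYvar, div_le_iff₀ (by positivity)]
    nlinarith
  calc _ ≤ ENNReal.ofReal 16⁻¹ := ENNReal.ofReal_le_ofReal this
    _ = 16⁻¹ := by rw [ENNReal.ofReal_inv_of_pos (by norm_num)]; simp

theorem measure_medianOfMeans_dev_le {K L : ℕ} {Ω : Type*} [MeasurableSpace Ω]
    (μ : Measure Ω) [IsProbabilityMeasure μ] {X : Ω → ℝ} (hXm : Measurable X) (hX : MemLp X 2 μ)
    {V c : ℝ} (hc : 0 < c) (hV : ∫ ω, X ω ^ 2 ∂μ ≤ V) (hL : 0 < L) (hLc : 16 * V ≤ L * c ^ 2) :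
    Measure.pi (fun _ : Fin K × Fin L => μ)
      {data | c ≤ |median (fun k => (∑ l, X (data (k, l))) / L) - ∫ ω, X ω ∂μ|} ≤ 2⁻¹ ^ K :=
  measure_median_dev_le μ (f := fun x : Fin L → Ω => (∑ l, X (x l)) / L)
    (by fun_prop) _ _ (measure_mean_dev_le μ hX hc hV hL hLc)

/-! ### The truncated Gaussian filter -/

/-- Chernoff's bound on each of the two tails. -/
theorem gaussianReal_Icc_compl_le {v : NNReal} {T : ℝ} (hT : 0 ≤ T) :
    (gaussianReal 0 v).real (Set.Icc (-T) T)ᶜ ≤ 2 * Real.exp (-T ^ 2 / (2 * v)) := by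
  have hsub : HasSubgaussianMGF (fun x => x) v (gaussianReal 0 v) :=
    ⟨fun t => integrable_exp_mul_gaussianReal t, fun t => by rw [mgf_fun_id_gaussianReal]; simp⟩
  have h1 := hsub.measure_ge_le hT
  have h2 := hsub.neg.measure_ge_le hT
  have hss : (Set.Icc (-T) T)ᶜ ⊆ {x : ℝ | T ≤ x} ∪ {x : ℝ | T ≤ (-fun x => x) x} := by
    intro x hx
    simp only [Set.mem_compl_iff, Set.mem_Icc, not_and_or, not_le] at hx
    rcases hx with hx | hx
    · right; change T ≤ -x; linarith
    · left; exact hx.le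
  calc _ ≤ _ := measureReal_mono hss
    _ ≤ _ := measureReal_union_le _ _
    _ ≤ _ := by linarith

theorem gaussianReal_Icc_pos {v : NNReal} (hv : v ≠ 0) {T : ℝ} (hT : 0 < T) :
    gaussianReal 0 v (Set.Icc (-T) T) ≠ 0 := by
  intro h
  have h1 := gaussianReal_absolutelyContinuous' 0 hv h
  rw [Real.volume_Icc] at h1
  simp at h1
  linarith

theorem toNNReal_two_mul_sq_ne_zero {τ : ℝ} (hτ : 0 < τ) : Real.toNNReal (2 * τ ^ 2) ≠ 0 := by
  have : 0 < 2 * τ ^ 2 := by positivity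
  simpa using this

theorem isProbabilityMeasure_timeLaw {τ T : ℝ} (hτ : 0 < τ) (hT : 0 < T) :
    IsProbabilityMeasure (timeLaw τ T) :=
  cond_isProbabilityMeasure (gaussianReal_Icc_pos (toNNReal_two_mul_sq_ne_zero hτ) hT)

/-- Without truncation the value is the Gaussian characteristic function `e^{-τ²x²}`. Discarding the
tails changes it by at most their mass, and `hq` leaves mass at least 1/2 inside, so renormalising
costs at most a factor 2. -/
theorem norm_integral_timeLaw_le {τ T : ℝ} (hτ : 0 < τ) (hT : 0 < T)
    (hq : 2 * Real.exp (-T ^ 2 / (4 * τ ^ 2)) ≤ 1 / 2) (x : ℝ) :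
    ‖∫ t, Complex.exp (-((t * x : ℝ) : ℂ) * Complex.I) ∂timeLaw τ T‖
      ≤ 2 * (Real.exp (-(τ ^ 2 * x ^ 2)) + 2 * Real.exp (-T ^ 2 / (4 * τ ^ 2))) := by
  set v := Real.toNNReal (2 * τ ^ 2) with hv
  set μ := gaussianReal 0 v with hμ
  set A := Set.Icc (-T) T with hA
  have hvr : (v : ℝ) = 2 * τ ^ 2 := Real.coe_toNNReal _ (by positivity)
  have hq1 : μ.real Aᶜ ≤ 2 * Real.exp (-T ^ 2 / (4 * τ ^ 2)) := by
    refine (gaussianReal_Icc_compl_le hT.le).trans_eq ?_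
    rw [hvr]; ring_nf
  have hAm : MeasurableSet A := measurableSet_Icc
  have hA1 : μ.real A = 1 - μ.real Aᶜ := by
    rw [probReal_compl_eq_one_sub hAm]; ring
  have hA2 : 1 / 2 ≤ μ.real A := by rw [hA1]; linarith
  set f : ℝ → ℂ := fun t => Complex.exp (-((t * x : ℝ) : ℂ) * Complex.I) with hf
  have hfn : ∀ t, ‖f t‖ = 1 := fun t => by
    simp only [hf]
    rw [← Complex.ofReal_neg, Complex.norm_exp_ofReal_mul_I]
  have hfi : Integrable f μ := by
    refine Integrable.of_bound (C := 1) ?_ (Filter.Eventually.of_forall fun t => (hfn t).le)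
    exact Continuous.aestronglyMeasurable (by fun_prop)
  have hchar : ∫ t, f t ∂μ = (Real.exp (-(τ ^ 2 * x ^ 2)) : ℂ) := by
    have h1 := charFun_gaussianReal (μ := 0) (v := v) (-x)
    rw [charFun_apply_real] at h1
    rw [show ∫ t, f t ∂μ = ∫ t, Complex.exp (((-x : ℝ) : ℂ) * t * Complex.I) ∂μ from ?_, h1]
    · rw [show ((v : NNReal) : ℂ) = ((2 * τ ^ 2 : ℝ) : ℂ) by rw [← hvr]]
      push_cast
      ring_nf
    · refine integral_congr_ae (Filter.Eventually.of_forall fun t => ?_)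
      simp only [hf]
      push_cast
      ring_nf
  have hint : ∫ t, f t ∂timeLaw τ T = (μ.real A)⁻¹ • ∫ t in A, f t ∂μ := by
    rw [timeLaw, ProbabilityTheory.cond, integral_smul_measure]
    rw [ENNReal.toReal_inv]; rfl
  have hsplit : ∫ t in A, f t ∂μ = ∫ t, f t ∂μ - ∫ t in Aᶜ, f t ∂μ :=
    eq_sub_of_add_eq (integral_add_compl hAm hfi)
  have hc : ‖∫ t in Aᶜ, f t ∂μ‖ ≤ μ.real Aᶜ := by
    have := norm_setIntegral_le_of_norm_le_const (μ := μ) (s := Aᶜ) (f := f) (C := 1)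
      (measure_lt_top _ _) (fun t _ => (hfn t).le)
    simpa using this
  have hb : ‖∫ t in A, f t ∂μ‖ ≤ Real.exp (-(τ ^ 2 * x ^ 2))
      + 2 * Real.exp (-T ^ 2 / (4 * τ ^ 2)) := by
    rw [hsplit, hchar]
    refine (norm_sub_le _ _).trans ?_
    rw [Complex.norm_real, Real.norm_of_nonneg (Real.exp_pos _).le]
    linarith
  rw [hint, norm_smul, norm_inv, Real.norm_of_nonneg (by linarith)]
  have : (μ.real A)⁻¹ ≤ 2 := by
    rw [inv_le_comm₀ (by linarith) (by norm_num)]; linarith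
  gcongr

/-! ### Time evolution in the eigenbasis -/

theorem ofLp_toEuclideanLin {m : Type*} [Fintype m] [DecidableEq m] (A : Matrix m m ℂ)
    (v : EuclideanSpace ℂ m) : (Matrix.toEuclideanLin A v).ofLp = A.mulVec v.ofLp :=
  rfl

theorem exp_mulVec_of_eigenvector {m : Type*} [Fintype m] [DecidableEq m] {A : Matrix m m ℂ}
    {v : m → ℂ} {c : ℂ} (h : A.mulVec v = c • v) :
    (NormedSpace.exp A).mulVec v = Complex.exp c • v := by
  open scoped Matrix.Norms.Operator in
  have h1 := NormedSpace.exp_series_hasSum_exp' (𝕂 := ℂ) A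
  have hpow : ∀ k : ℕ, (A ^ k).mulVec v = c ^ k • v := by
    intro k
    induction k with
    | zero => simp
    | succ k ih => rw [pow_succ, ← Matrix.mulVec_mulVec, h, Matrix.mulVec_smul, ih, smul_smul,
        pow_succ, mul_comm]
  have h2 : HasSum (fun k : ℕ => ((k.factorial : ℂ)⁻¹ • A ^ k).mulVec v)
      ((NormedSpace.exp A).mulVec v) :=
    h1.map (⟨⟨fun B : Matrix m m ℂ => B.mulVec v, by simp⟩, fun B C => Matrix.add_mulVec B C v⟩ :
      Matrix m m ℂ →+ (m → ℂ)) (Continuous.matrix_mulVec continuous_id continuous_const)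
  have h3 : HasSum (fun k : ℕ => ((k.factorial : ℂ)⁻¹ * c ^ k) • v) (Complex.exp c • v) := by
    have := NormedSpace.exp_series_hasSum_exp' (𝕂 := ℂ) c
    rw [← Complex.exp_eq_exp_ℂ] at this
    exact this.smul_const v
  refine h2.unique ?_
  convert h3 using 2 with k
  rw [Matrix.smul_mulVec, hpow, smul_smul]

/-- The state `e^{itω} e^{-itH} ψ`, expanded in an eigenbasis of `H`. -/
noncomputable def evolved {n : ℕ} (E : Fin (2 ^ n) → ℝ)
    (b : OrthonormalBasis (Fin (2 ^ n)) ℂ (Ket n)) (ω : ℝ) (ψ : Ket n) (t : ℝ) : Ket n :=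
  ∑ k, (Complex.exp (-((t * (E k - ω) : ℝ) : ℂ) * Complex.I) * inner ℂ (b k) ψ) • b k

section evolved
variable {n : ℕ} {H : Op n} {E : Fin (2 ^ n) → ℝ} {b : OrthonormalBasis (Fin (2 ^ n)) ℂ (Ket n)}
  (ω : ℝ) (ψ : Ket n)

theorem toEuclideanLin_phasedEvolution (hH : IsSortedEigenbasis H E b) (t : ℝ) :
    Matrix.toEuclideanLin (phasedEvolution H ω t) ψ = evolved E b ω ψ t := by
  have hb : ∀ k, Matrix.toEuclideanLin (phasedEvolution H ω t) (b k)
      = Complex.exp (-((t * (E k - ω) : ℝ) : ℂ) * Complex.I) • b k := by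
    intro k
    have h1 : ((-(t : ℂ) * Complex.I) • H).mulVec (b k).ofLp
        = ((-(t : ℂ) * Complex.I) * E k) • (b k).ofLp := by
      have := congrArg WithLp.ofLp (hH.eigen k)
      rw [ofLp_toEuclideanLin] at this
      rw [Matrix.smul_mulVec, this, WithLp.ofLp_smul, smul_smul]
    have h2 := exp_mulVec_of_eigenvector h1
    apply WithLp.ofLp_injective
    rw [ofLp_toEuclideanLin, phasedEvolution, Matrix.smul_mulVec, h2, smul_smul,
      ← Complex.exp_add, WithLp.ofLp_smul]
    congr 2
    push_cast
    ring
  conv_lhs => rw [← b.sum_repr' ψ]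
  rw [map_sum, evolved]
  refine Finset.sum_congr rfl fun k _ => ?_
  rw [map_smul, hb, smul_smul, mul_comm]

theorem inner_evolved (k : Fin (2 ^ n)) (t : ℝ) :
    inner ℂ (b k) (evolved E b ω ψ t)
      = Complex.exp (-((t * (E k - ω) : ℝ) : ℂ) * Complex.I) * inner ℂ (b k) ψ :=
  b.orthonormal.inner_right_fintype _ k

theorem norm_exp_neg_ofReal_mul_I (x : ℝ) : ‖Complex.exp (-(x : ℂ) * Complex.I)‖ = 1 := by
  rw [← Complex.ofReal_neg, Complex.norm_exp_ofReal_mul_I]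

theorem norm_evolved (t : ℝ) : ‖evolved E b ω ψ t‖ = ‖ψ‖ := by
  have h1 := b.sum_sq_norm_inner_right (evolved E b ω ψ t)
  have h2 := b.sum_sq_norm_inner_right ψ
  have : ‖evolved E b ω ψ t‖ ^ 2 = ‖ψ‖ ^ 2 := by
    rw [← h1, ← h2]
    refine Finset.sum_congr rfl fun k _ => ?_
    rw [inner_evolved, norm_mul, norm_exp_neg_ofReal_mul_I, one_mul]
  exact (sq_eq_sq₀ (norm_nonneg _) (norm_nonneg _)).1 this

theorem continuous_evolved : Continuous (evolved E b ω ψ) := by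
  unfold evolved
  fun_prop

theorem integrable_evolved (μ : Measure ℝ) [IsFiniteMeasure μ] :
    Integrable (evolved E b ω ψ) μ :=
  Integrable.of_bound (C := ‖ψ‖) (continuous_evolved ω ψ).aestronglyMeasurable
    (Filter.Eventually.of_forall fun t => (norm_evolved ω ψ t).le)

/-- The filtered state: the average of the evolved state over the random evolution time. -/
noncomputable def filtered (E : Fin (2 ^ n) → ℝ) (b : OrthonormalBasis (Fin (2 ^ n)) ℂ (Ket n))
    (ω : ℝ) (ψ : Ket n) (τ T : ℝ) : Ket n :=
  ∫ t, evolved E b ω ψ t ∂timeLaw τ T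

theorem inner_filtered {τ T : ℝ} (hτ : 0 < τ) (hT : 0 < T) (k : Fin (2 ^ n)) :
    inner ℂ (b k) (filtered E b ω ψ τ T)
      = (∫ t, Complex.exp (-((t * (E k - ω) : ℝ) : ℂ) * Complex.I) ∂timeLaw τ T)
        * inner ℂ (b k) ψ := by
  have := isProbabilityMeasure_timeLaw hτ hT
  rw [filtered, ← integral_inner (integrable_evolved ω ψ _)]
  simp_rw [inner_evolved]
  rw [integral_mul_const]

end evolved

/-- By monotonicity every other level lies beyond the neighbour of `j` on its side. With a single
level the infimum is over the empty set and equals 0, so a positive gap excludes that case. -/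
theorem le_abs_sub_of_energyGap {n : ℕ} {E : Fin n → ℝ} (hE : Monotone E) (j k : Fin n)
    (hk : k ≠ j) : energyGap E j ≤ |E k - E j| := by
  have hle : ∀ i : Fin n, (i.val = j.val + 1 ∨ i.val + 1 = j.val) →
      energyGap E j ≤ |E i - E j| := fun i hi =>
    ciInf_le (f := fun k : {k : Fin n // k.val = j.val + 1 ∨ k.val + 1 = j.val} => |E k - E j|)
      (Set.finite_range _).bddBelow ⟨i, hi⟩
  rcases lt_or_gt_of_ne hk with h | h
  · have hlt : j.val - 1 < n := by omega
    have h1 := hle ⟨j.val - 1, hlt⟩ (Or.inr (by have : k.val < j.val := h; simp; omega))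
    have h2 : E k ≤ E ⟨j.val - 1, hlt⟩ := hE (Fin.le_def.2 (by have : k.val < j.val := h; simp; omega))
    have h3 : E ⟨j.val - 1, hlt⟩ ≤ E j := hE (Fin.le_def.2 (by simp))
    rw [abs_of_nonpos (by linarith)] at h1 ⊢
    linarith
  · have hlt : j.val + 1 < n := by have : j.val < k.val := h; omega
    have h1 := hle ⟨j.val + 1, hlt⟩ (Or.inl rfl)
    have h2 : E ⟨j.val + 1, hlt⟩ ≤ E k := hE (Fin.le_def.2 (by have : j.val < k.val := h; simp; omega))
    have h3 : E j ≤ E ⟨j.val + 1, hlt⟩ := hE (Fin.le_def.2 (by simp))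
    rw [abs_of_nonneg (by linarith)] at h1 ⊢
    linarith

/-- The filter keeps the target component and suppresses all others. -/
theorem exists_filtered_eq {n : ℕ} {E : Fin (2 ^ n) → ℝ}
    {b : OrthonormalBasis (Fin (2 ^ n)) ℂ (Ket n)} (hE : Monotone E) (j : Fin (2 ^ n))
    (ψ : Ket n) (hψ : ‖ψ‖ = 1) {τ T e : ℝ} (hτ : 0 < τ) (hT : 0 < T) (hΔ : 0 < energyGap E j)
    (hq : 2 * Real.exp (-T ^ 2 / (4 * τ ^ 2)) ≤ 1 / 2)
    (he : 2 * (Real.exp (-(τ ^ 2 * energyGap E j ^ 2)) + 2 * Real.exp (-T ^ 2 / (4 * τ ^ 2))) ≤ e) :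
    ∃ r : Ket n, filtered E b (E j) ψ τ T = (inner ℂ (b j) ψ : ℂ) • b j + r ∧
      inner ℂ (b j) r = (0 : ℂ) ∧ ‖r‖ ≤ e := by
  have := isProbabilityMeasure_timeLaw hτ hT
  have hb1 : inner ℂ (b j) (b j) = (1 : ℂ) := by
    rw [inner_self_eq_norm_sq_to_K, b.norm_eq_one]; simp
  refine ⟨filtered E b (E j) ψ τ T - (inner ℂ (b j) ψ : ℂ) • b j, by abel, ?_, ?_⟩
  -- The phase vanishes at the filter centre and the conditioned law has mass one, so the `j`-th
  -- coefficient survives exactly.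
  · rw [inner_sub_right, inner_filtered _ _ hτ hT, inner_smul_right, hb1]
    simp
  · have he0 : 0 ≤ e := le_trans (by positivity) he
    rw [← sq_le_sq₀ (norm_nonneg _) he0, ← b.sum_sq_norm_inner_right]
    calc _ ≤ ∑ k, e ^ 2 * ‖(inner ℂ (b k) ψ : ℂ)‖ ^ 2 := by
          refine Finset.sum_le_sum fun k _ => ?_
          rw [inner_sub_right, inner_filtered _ _ hτ hT, inner_smul_right]
          by_cases hk : k = j
          · subst hk
            rw [hb1]
            simp
            positivity
          · rw [b.inner_eq_zero hk, mul_zero, sub_zero, norm_mul, mul_pow]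
            gcongr
            refine (norm_integral_timeLaw_le hτ hT hq _).trans (le_trans ?_ he)
            gcongr 2 * (Real.exp (-(τ ^ 2 * ?_)) + _)
            exact sq_le_sq.2 (by
              rw [abs_of_pos hΔ]; exact le_abs_sub_of_energyGap hE j k hk)
      _ = e ^ 2 := by rw [← Finset.mul_sum, b.sum_sq_norm_inner_right, hψ]; simp

/-! ### The measurement channel and the shadow norm -/

section channel
variable {n : ℕ}

theorem rotated_apply_self (R : QUnitary n) (A : Op n) (z : Bits n) :
    rotated R A z z = ∑ j, (∑ i, (R : Op n) z i * A i j) * star ((R : Op n) z j) := by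
  simp [rotated, Matrix.mul_apply]

theorem continuous_rotated (A : Op n) (z : Bits n) :
    Continuous fun R : QUnitary n => rotated R A z z := by
  have : Continuous fun R : QUnitary n => (R : Op n) := continuous_subtype_val
  unfold rotated
  fun_prop

/-- A crude bound uniform in `R`; it provides integrability and boundedness and never enters the
final constants. -/
theorem norm_rotated_le (R : QUnitary n) (A : Op n) (z : Bits n) :
    ‖rotated R A z z‖ ≤ ∑ j, ∑ i, ‖A i j‖ := by
  rw [rotated_apply_self]
  refine (norm_sum_le _ _).trans (Finset.sum_le_sum fun j _ => ?_)
  rw [norm_mul, norm_star]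
  have hR : ∀ i, ‖(R : Op n) z i‖ ≤ 1 := fun i => entry_norm_bound_of_unitary R.2 z i
  calc _ ≤ ‖∑ i, (R : Op n) z i * A i j‖ * 1 := by gcongr; exact hR j
    _ ≤ ∑ i, ‖(R : Op n) z i * A i j‖ := by rw [mul_one]; exact norm_sum_le _ _
    _ ≤ _ := Finset.sum_le_sum fun i _ => by
        rw [norm_mul]; exact mul_le_of_le_one_left (norm_nonneg _) (hR i)

theorem rotated_one (R : QUnitary n) : rotated R 1 = 1 := by
  have := Matrix.mem_unitaryGroup_iff.1 R.2
  simpa [rotated, Matrix.star_eq_conjTranspose] using this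

theorem trace_mul_rawSnapshot (A : Op n) (R : QUnitary n) (z : Bits n) :
    (A * rawSnapshot R z).trace = rotated R A z z := by
  rw [rawSnapshot, ← Matrix.mul_assoc, Matrix.trace_mul_comm, ← Matrix.mul_assoc,
    ← Matrix.mul_assoc, Matrix.trace_mul_single]
  simp [rotated]

theorem sum_rawSnapshot (R : QUnitary n) : ∑ z, rawSnapshot R z = 1 := by
  have h : ∑ z : Bits n, Matrix.single z z (1 : ℂ) = 1 := by
    rw [← Matrix.diagonal_one, Matrix.sum_single_eq_diagonal]
  simp_rw [rawSnapshot]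
  rw [← Finset.sum_mul, ← Finset.mul_sum, h, Matrix.mul_one]
  exact Matrix.mem_unitaryGroup_iff'.1 R.2

theorem continuous_rawSnapshot (z v w : Bits n) :
    Continuous fun R : QUnitary n => rawSnapshot R z v w := by
  have : Continuous fun R : QUnitary n => (R : Op n) := continuous_subtype_val
  have h : Continuous fun R : QUnitary n => rawSnapshot R z := by
    unfold rawSnapshot
    fun_prop
  exact h.matrix_elem v w

theorem rawSnapshot_apply (R : QUnitary n) (z v w : Bits n) :
    rawSnapshot R z v w = star ((R : Op n) z v) * (R : Op n) z w := by
  simp [rawSnapshot, Matrix.mul_apply, Matrix.single_apply, ite_and]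

theorem norm_rawSnapshot_le (R : QUnitary n) (z v w : Bits n) : ‖rawSnapshot R z v w‖ ≤ 1 := by
  rw [rawSnapshot_apply, norm_mul, norm_star]
  exact mul_le_one₀ (entry_norm_bound_of_unitary R.2 z v) (norm_nonneg _)
    (entry_norm_bound_of_unitary R.2 z w)

variable (P : Measure (QUnitary n)) [IsProbabilityMeasure P]

theorem integrable_shadowChannel_apply (X : Op n) (z v w : Bits n) :
    Integrable (fun R : QUnitary n => rotated R X z z * rawSnapshot R z v w) P := by
  refine Integrable.of_bound (C := (∑ j, ∑ i, ‖X i j‖) * 1)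
    ((continuous_rotated X z).mul (continuous_rawSnapshot z v w)).aestronglyMeasurable
    (Filter.Eventually.of_forall fun R => ?_)
  rw [norm_mul]
  gcongr
  · exact norm_rotated_le R X z
  · exact norm_rawSnapshot_le R z v w

/-- The right-hand side is symmetric in `A` and `X`: the measurement channel is self-adjoint for the
trace pairing. -/
theorem trace_mul_shadowChannel (A X : Op n) :
    (A * shadowChannel P X).trace = ∫ R, ∑ z, rotated R X z z * rotated R A z z ∂P := by
  have h1 : (A * shadowChannel P X).trace
      = ∑ v, ∑ w, ∫ R, A v w * ∑ z, rotated R X z z * rawSnapshot R z w v ∂P := by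
    simp only [Matrix.trace, Matrix.diag_apply, Matrix.mul_apply, shadowChannel, Matrix.of_apply,
      integral_const_mul]
  have hi : ∀ v w, Integrable
      (fun R => A v w * ∑ z, rotated R X z z * rawSnapshot R z w v) P := fun v w =>
    (integrable_finsetSum _ fun z _ => integrable_shadowChannel_apply P X z w v).const_mul _
  rw [h1]
  simp_rw [← integral_finsetSum _ fun w _ => hi _ w]
  rw [← integral_finsetSum _ fun v _ => integrable_finsetSum _ fun w _ => hi v w]
  refine integral_congr_ae (Filter.Eventually.of_forall fun R => ?_)
  simp only [← trace_mul_rawSnapshot A R]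
  simp only [Matrix.trace, Matrix.diag_apply, Matrix.mul_apply, Finset.mul_sum]
  rw [Finset.sum_comm_cycle]
  refine Finset.sum_congr rfl fun z _ => Finset.sum_congr rfl fun v _ =>
    Finset.sum_congr rfl fun w _ => by ring

theorem trace_mul_shadowChannel_comm (A X : Op n) :
    (A * shadowChannel P X).trace = (X * shadowChannel P A).trace := by
  rw [trace_mul_shadowChannel, trace_mul_shadowChannel]
  simp_rw [mul_comm]

theorem shadowChannel_one : shadowChannel P (1 : Op n) = 1 := by
  ext v w
  simp only [shadowChannel, rotated_one, Matrix.one_apply_eq, one_mul, Matrix.of_apply]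
  simp_rw [← Matrix.sum_apply, sum_rawSnapshot]
  simp

variable {P} (hP : TomographicallyComplete P)
include hP

omit [IsProbabilityMeasure P] in
theorem shadowChannel_shadowInverse (O : Op n) : shadowChannel P (shadowInverse P O) = O :=
  Function.invFun_eq (hP.2 O)

theorem shadowInverse_one : shadowInverse P (1 : Op n) = 1 :=
  hP.1 (by rw [shadowChannel_shadowInverse hP, shadowChannel_one])

/-- Self-adjointness moves `ℳ⁻¹` from the snapshot to the observable, producing the quantity that
the shadow norm controls. -/
theorem trace_mul_shadowInverse_rawSnapshot (O : Op n) (R : QUnitary n) (z : Bits n) :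
    (O * shadowInverse P (rawSnapshot R z)).trace = rotated R (shadowInverse P O) z z := by
  calc (O * shadowInverse P (rawSnapshot R z)).trace
      = (shadowInverse P (rawSnapshot R z) * shadowChannel P (shadowInverse P O)).trace := by
        rw [Matrix.trace_mul_comm, shadowChannel_shadowInverse hP]
    _ = (shadowInverse P O * rawSnapshot R z).trace := by
        rw [trace_mul_shadowChannel_comm, shadowChannel_shadowInverse hP]
    _ = _ := trace_mul_rawSnapshot _ _ _

theorem shotEstimate_eq (O : Op n) (s : Shot n) :
    shotEstimate P O s
      = outcomeSign s.2.2.1 * (rotated s.2.1 (shadowInverse P O) s.2.2.2 s.2.2.2).re := by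
  rw [shotEstimate, stateEstimator, Matrix.mul_smul, Matrix.trace_smul,
    trace_mul_shadowInverse_rawSnapshot hP, smul_eq_mul, Complex.re_ofReal_mul]

end channel

/-! ### Born probabilities and unbiasedness of classical shadows -/

section born
variable {n : ℕ}

/-- The probability of the outcome `z` when the state `v` is measured after applying `R`. -/
noncomputable def bornProb (R : QUnitary n) (v : Ket n) (z : Bits n) : ℝ :=
  Complex.normSq ((R : Op n).mulVec v.ofLp z)

theorem bornProb_nonneg (R : QUnitary n) (v : Ket n) (z : Bits n) : 0 ≤ bornProb R v z :=
  Complex.normSq_nonneg _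

theorem rotated_pureState (R : QUnitary n) (v : Ket n) (z : Bits n) :
    rotated R (pureState v) z z = (bornProb R v z : ℂ) := by
  rw [rotated, pureState, Matrix.mul_vecMulVec, Matrix.vecMulVec_mul, Matrix.vecMulVec_apply,
    bornProb, Complex.normSq_eq_conj_mul_self, mul_comm, ← Matrix.star_mulVec]
  rfl

theorem sum_bornProb (R : QUnitary n) (v : Ket n) : ∑ z, bornProb R v z = ‖v‖ ^ 2 := by
  have h : ∀ u : Bits n → ℂ, ((∑ z, Complex.normSq (u z) : ℝ) : ℂ) = star u ⬝ᵥ u := by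
    intro u
    rw [dotProduct, Complex.ofReal_sum]
    exact Finset.sum_congr rfl fun z _ => Complex.normSq_eq_conj_mul_self
  have h1 : ((∑ z, bornProb R v z : ℝ) : ℂ) = ((∑ z, Complex.normSq (v.ofLp z) : ℝ) : ℂ) := by
    rw [h]
    refine (h ((R : Op n).mulVec v.ofLp)).trans ?_
    rw [Matrix.star_mulVec, Matrix.dotProduct_mulVec, Matrix.vecMul_vecMul]
    have : (R : Op n).conjTranspose * (R : Op n) = 1 := Matrix.mem_unitaryGroup_iff'.1 R.2
    rw [this, Matrix.vecMul_one]
  rw [Complex.ofReal_inj.1 h1, EuclideanSpace.norm_sq_eq]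
  exact Finset.sum_congr rfl fun z _ => Complex.normSq_eq_norm_sq _

theorem mul_pureState_mul (K : Op n) (ψ : Ket n) :
    K * pureState ψ * K.conjTranspose = pureState (Matrix.toEuclideanLin K ψ) := by
  rw [pureState, pureState, Matrix.mul_vecMulVec, Matrix.vecMulVec_mul, ofLp_toEuclideanLin,
    Matrix.star_mulVec]

theorem expectation_eq_trace (O : Op n) (v : Ket n) :
    expectation O v = (pureState v * O).trace.re := by
  rw [expectation, pureState, Matrix.trace_mul_comm, Matrix.mul_vecMulVec, Matrix.trace_vecMulVec,
    EuclideanSpace.inner_eq_star_dotProduct, ofLp_toEuclideanLin]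

theorem isDensity_pureState {v : Ket n} (hv : ‖v‖ = 1) : IsDensity (pureState v) := by
  refine ⟨Matrix.posSemidef_vecMulVec_self_star _, ?_⟩
  rw [pureState, Matrix.trace_vecMulVec, ← EuclideanSpace.inner_eq_star_dotProduct,
    inner_self_eq_norm_sq_to_K, hv]
  simp

theorem continuous_bornProb (v : Ket n) (z : Bits n) :
    Continuous fun R : QUnitary n => bornProb R v z := by
  have h := Complex.continuous_re.comp (continuous_rotated (pureState v) z)
  refine h.congr fun R => ?_
  simp [rotated_pureState]

theorem bornProb_le (R : QUnitary n) (v : Ket n) (z : Bits n) : bornProb R v z ≤ ‖v‖ ^ 2 := by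
  rw [← sum_bornProb R v]
  exact Finset.single_le_sum (f := fun z => bornProb R v z) (fun z _ => bornProb_nonneg R v z)
    (Finset.mem_univ z)

variable (P : Measure (QUnitary n)) [IsProbabilityMeasure P]

theorem integrable_bornProb_mul (v : Ket n) (z : Bits n) {g : QUnitary n → ℝ}
    (hg : Continuous g) {C : ℝ} (hC : ∀ R, |g R| ≤ C) :
    Integrable (fun R => bornProb R v z * g R) P := by
  refine Integrable.of_bound (C := ‖v‖ ^ 2 * C)
    ((continuous_bornProb v z).mul hg).aestronglyMeasurable
    (Filter.Eventually.of_forall fun R => ?_)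
  rw [norm_mul, Real.norm_of_nonneg (bornProb_nonneg _ _ _)]
  exact mul_le_mul (bornProb_le R v z) (hC R) (abs_nonneg _) (sq_nonneg _)

theorem abs_re_rotated_le (R : QUnitary n) (A : Op n) (z : Bits n) :
    |(rotated R A z z).re| ≤ ∑ j, ∑ i, ‖A i j‖ :=
  (Complex.abs_re_le_norm _).trans (norm_rotated_le R A z)

theorem continuous_re_rotated (A : Op n) (z : Bits n) :
    Continuous fun R : QUnitary n => (rotated R A z z).re :=
  Complex.continuous_re.comp (continuous_rotated A z)

theorem re_rotated_sq_le (R : QUnitary n) (A : Op n) (z : Bits n) :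
    (rotated R A z z).re ^ 2 ≤ (∑ j, ∑ i, ‖A i j‖) ^ 2 :=
  sq_le_sq.2 ((abs_re_rotated_le R A z).trans (le_abs_self _))

theorem integrable_bornProb_mul_re (v : Ket n) (A : Op n) (z : Bits n) :
    Integrable (fun R => bornProb R v z * (rotated R A z z).re) P :=
  integrable_bornProb_mul P v z (continuous_re_rotated A z) fun R => abs_re_rotated_le R A z

theorem integrable_bornProb_mul_re_sq (v : Ket n) (A : Op n) (z : Bits n) :
    Integrable (fun R => bornProb R v z * (rotated R A z z).re ^ 2) P :=
  integrable_bornProb_mul P v z ((continuous_re_rotated A z).pow 2) fun R => by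
    rw [abs_of_nonneg (sq_nonneg _)]; exact re_rotated_sq_le R A z

variable {P}

/-- Classical shadows are unbiased. -/
theorem integral_bornProb_mul_re (hP : TomographicallyComplete P) (O : Op n) (v : Ket n) :
    ∫ R, ∑ z, bornProb R v z * (rotated R (shadowInverse P O) z z).re ∂P = expectation O v := by
  rw [expectation_eq_trace]
  conv_rhs => rw [← shadowChannel_shadowInverse hP O, trace_mul_shadowChannel]
  have hi : Integrable (fun R => ∑ z, rotated R (shadowInverse P O) z z
      * rotated R (pureState v) z z) P := by
    refine integrable_finsetSum _ fun z _ => ?_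
    refine Integrable.of_bound (C := (∑ j, ∑ i, ‖shadowInverse P O i j‖)
      * ∑ j, ∑ i, ‖pureState v i j‖)
      ((continuous_rotated _ z).mul (continuous_rotated _ z)).aestronglyMeasurable
      (Filter.Eventually.of_forall fun R => ?_)
    rw [norm_mul]
    gcongr
    · exact norm_rotated_le R _ z
    · exact norm_rotated_le R _ z
  refine Eq.trans ?_ (Complex.reCLM.integral_comp_comm hi)
  refine integral_congr_ae (Filter.Eventually.of_forall fun R => ?_)
  simp only [Complex.reCLM_apply, Complex.re_sum, rotated_pureState, Complex.re_mul_ofReal]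
  exact Finset.sum_congr rfl fun z _ => mul_comm _ _

/-- A real supremum is an upper bound only for a bounded family. Boundedness holds because the
diagonal of `R σ R†` is a probability vector. -/
theorem integral_le_shadowNorm_sq (O : Op n) {σ : Op n} (hσ : IsDensity σ) :
    ∫ R, ∑ z, (rotated R σ z z).re * (rotated R (shadowInverse P O) z z).re ^ 2 ∂P
      ≤ shadowNorm P O ^ 2 := by
  set C := ∑ j, ∑ i, ‖shadowInverse P O i j‖
  have hdiag : ∀ σ : Op n, IsDensity σ → ∀ (R : QUnitary n) z, 0 ≤ (rotated R σ z z).re := by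
    intro σ hσ R z
    have := (hσ.1.mul_mul_conjTranspose_same (R : Op n)).diag_nonneg (i := z)
    exact (Complex.nonneg_iff.1 this).1
  have htr : ∀ σ : Op n, IsDensity σ → ∀ R : QUnitary n, ∑ z, (rotated R σ z z).re = 1 := by
    intro σ hσ R
    have h : (rotated R σ).trace = 1 := by
      rw [rotated, Matrix.trace_mul_comm, ← Matrix.mul_assoc]
      have : (R : Op n).conjTranspose * (R : Op n) = 1 := Matrix.mem_unitaryGroup_iff'.1 R.2
      rw [this, Matrix.one_mul, hσ.2]
    have h2 := congrArg Complex.re h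
    simpa [Matrix.trace] using h2
  have hnn : ∀ σ : {σ : Op n // IsDensity σ}, 0 ≤
      ∫ R, ∑ z, (rotated R σ.1 z z).re * (rotated R (shadowInverse P O) z z).re ^ 2 ∂P := fun σ =>
    integral_nonneg fun R => Finset.sum_nonneg fun z _ =>
      mul_nonneg (hdiag σ.1 σ.2 R z) (sq_nonneg _)
  have hbdd : BddAbove (Set.range fun σ : {σ : Op n // IsDensity σ} =>
      ∫ R, ∑ z, (rotated R σ.1 z z).re * (rotated R (shadowInverse P O) z z).re ^ 2 ∂P) := by
    refine ⟨C ^ 2, ?_⟩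
    rintro _ ⟨σ, rfl⟩
    have hpt : ∀ R : QUnitary n,
        ∑ z, (rotated R σ.1 z z).re * (rotated R (shadowInverse P O) z z).re ^ 2 ≤ C ^ 2 := by
      intro R
      calc _ ≤ ∑ z, (rotated R σ.1 z z).re * C ^ 2 := Finset.sum_le_sum fun z _ =>
            mul_le_mul_of_nonneg_left (re_rotated_sq_le R _ z) (hdiag σ.1 σ.2 R z)
        _ = C ^ 2 := by rw [← Finset.sum_mul, htr σ.1 σ.2 R, one_mul]
    refine (integral_mono_of_nonneg (Filter.Eventually.of_forall fun R => ?_)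
      (integrable_const (C ^ 2)) (Filter.Eventually.of_forall hpt)).trans_eq (by simp)
    exact Finset.sum_nonneg fun z _ => mul_nonneg (hdiag σ.1 σ.2 R z) (sq_nonneg _)
  rw [shadowNorm, Real.sq_sqrt (Real.iSup_nonneg hnn)]
  exact le_ciSup hbdd ⟨σ, hσ⟩

theorem integral_bornProb_mul_re_sq_le (O : Op n) {v : Ket n} (hv : ‖v‖ = 1) :
    ∫ R, ∑ z, bornProb R v z * (rotated R (shadowInverse P O) z z).re ^ 2 ∂P
      ≤ shadowNorm P O ^ 2 := by
  have := integral_le_shadowNorm_sq (P := P) O (isDensity_pureState hv)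
  simpa [rotated_pureState] using this

/-- The shadow norm dominates all expectation values. -/
theorem abs_expectation_le_shadowNorm (hP : TomographicallyComplete P) (O : Op n) {v : Ket n}
    (hv : ‖v‖ = 1) : |expectation O v| ≤ shadowNorm P O := by
  refine abs_le_of_sq_le_sq ?_ (Real.sqrt_nonneg _)
  refine le_trans ?_ (integral_bornProb_mul_re_sq_le (P := P) O hv)
  set X : QUnitary n → Bits n → ℝ := fun R z => (rotated R (shadowInverse P O) z z).re
  set c := expectation O v with hc
  have h1 : ∫ R, ∑ z, bornProb R v z * X R z ∂P = c := integral_bornProb_mul_re hP O v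
  have i1 : Integrable (fun R => ∑ z, bornProb R v z * X R z) P :=
    integrable_finsetSum _ fun z _ => integrable_bornProb_mul_re P v _ z
  have i2 : Integrable (fun R => ∑ z, bornProb R v z * X R z ^ 2) P :=
    integrable_finsetSum _ fun z _ => integrable_bornProb_mul_re_sq P v _ z
  -- Nonnegativity of the variance about `c` gives `c² ≤` second moment.
  have h0 : 0 ≤ ∫ R, ∑ z, bornProb R v z * (X R z - c) ^ 2 ∂P :=
    integral_nonneg fun R => Finset.sum_nonneg fun z _ =>
      mul_nonneg (bornProb_nonneg R v z) (sq_nonneg _)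
  have h2 : ∀ R, ∑ z, bornProb R v z * (X R z - c) ^ 2
      = ∑ z, bornProb R v z * X R z ^ 2 - 2 * c * ∑ z, bornProb R v z * X R z + c ^ 2 := by
    intro R
    have h3 : c ^ 2 = ∑ z, bornProb R v z * c ^ 2 := by
      rw [← Finset.sum_mul, sum_bornProb, hv]; ring
    rw [h3, Finset.mul_sum, ← Finset.sum_sub_distrib, ← Finset.sum_add_distrib]
    exact Finset.sum_congr rfl fun z _ => by ring
  simp_rw [h2] at h0
  have i3 : Integrable (fun R => ∑ z, bornProb R v z * X R z ^ 2
      - 2 * c * ∑ z, bornProb R v z * X R z) P := i2.sub (i1.const_mul _)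
  rw [integral_add i3 (integrable_const _), integral_sub i2 (i1.const_mul _), integral_const_mul, h1] at h0
  simp at h0
  linarith

end born

/-! ### The law of one run of the circuit -/

section shot
variable {n : ℕ}

/-- The unnormalised state after outcome `a` of the Hadamard test on `u` and `v`. -/
noncomputable def krausState (u v : Ket n) (a : Bool) : Ket n :=
  (1 / 2 : ℂ) • ((outcomeSign a : ℂ) • u + v)

theorem toEuclideanLin_hadamardKraus (U V : Op n) (a : Bool) (ψ : Ket n) :
    Matrix.toEuclideanLin (hadamardKraus U V a) ψ
      = krausState (Matrix.toEuclideanLin U ψ) (Matrix.toEuclideanLin V ψ) a := by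
  simp only [hadamardKraus, krausState, map_smul, map_add, LinearMap.smul_apply,
    LinearMap.add_apply]

/-- The parallelogram identity: unsigned summation over the ancilla cancels the interference terms.
-/
theorem sum_bornProb_krausState (R : QUnitary n) (u v : Ket n) (z : Bits n) :
    ∑ a, bornProb R (krausState u v a) z = (bornProb R u z + bornProb R v z) / 2 := by
  simp only [bornProb, krausState, WithLp.ofLp_smul, WithLp.ofLp_add, Matrix.mulVec_smul,
    Matrix.mulVec_add, Fintype.sum_bool, outcomeSign, Pi.smul_apply, Pi.add_apply, smul_eq_mul]
  simp [Complex.normSq_apply]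
  ring

/-- The polarised counterpart: the sign cancels `⟨u|O|u⟩` and `⟨v|O|v⟩` and keeps only the
interference terms. -/
theorem sum_outcomeSign_mul_expectation (O : Op n) (u v : Ket n) :
    ∑ a, outcomeSign a * expectation O (krausState u v a)
      = ((inner ℂ u (Matrix.toEuclideanLin O v)).re
        + (inner ℂ v (Matrix.toEuclideanLin O u)).re) / 2 := by
  simp only [expectation, krausState, map_smul, map_add, inner_smul_left, inner_smul_right,
    inner_add_left, inner_add_right, Fintype.sum_bool, outcomeSign]
  simp
  ring

theorem outcomeProb_eq {H : Op n} {E : Fin (2 ^ n) → ℝ}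
    {b : OrthonormalBasis (Fin (2 ^ n)) ℂ (Ket n)} (hH : IsSortedEigenbasis H E b) (ω : ℝ)
    (ψ : Ket n) (s : Shot n) :
    outcomeProb H ω ψ s = bornProb s.2.1
      (krausState (evolved E b ω ψ s.1.1) (evolved E b ω ψ s.1.2) s.2.2.1) s.2.2.2 := by
  simp only [outcomeProb]
  rw [mul_pureState_mul, toEuclideanLin_hadamardKraus, toEuclideanLin_phasedEvolution ω ψ hH,
    toEuclideanLin_phasedEvolution ω ψ hH, rotated_pureState, Complex.ofReal_re]

theorem measurable_shot {f : Shot n → ℝ}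
    (hf : ∀ a z, Measurable fun p : (ℝ × ℝ) × QUnitary n => f (p.1, p.2, a, z)) :
    Measurable f := by
  have h : Measurable fun p : ((ℝ × ℝ) × QUnitary n) × (Bool × Bits n) =>
      f (p.1.1, p.1.2, p.2) :=
    measurable_from_prod_countable_left fun y => hf y.1 y.2
  exact h.comp (g := fun p : ((ℝ × ℝ) × QUnitary n) × (Bool × Bits n) => f (p.1.1, p.1.2, p.2))
    (f := fun s : Shot n => ((s.1, s.2.1), s.2.2)) (by fun_prop)

theorem measurable_coe_apply (v w : Bits n) : Measurable fun R : QUnitary n => (R : Op n) v w := by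
  have : Continuous fun R : QUnitary n => (R : Op n) := continuous_subtype_val
  exact (this.matrix_elem v w).measurable

theorem measurable_outcomeProb {H : Op n} {E : Fin (2 ^ n) → ℝ}
    {b : OrthonormalBasis (Fin (2 ^ n)) ℂ (Ket n)} (hH : IsSortedEigenbasis H E b) (ω : ℝ)
    (ψ : Ket n) : Measurable (outcomeProb H ω ψ) := by
  refine measurable_shot fun a z => ?_
  simp only [outcomeProb_eq hH]
  have hc : ∀ w : Bits n, Measurable fun p : ℝ × ℝ =>
      krausState (evolved E b ω ψ p.1) (evolved E b ω ψ p.2) a w := by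
    intro w
    have hu := continuous_evolved (E := E) (b := b) ω ψ
    have h1 : Continuous fun p : ℝ × ℝ =>
        krausState (evolved E b ω ψ p.1) (evolved E b ω ψ p.2) a :=
      (((hu.comp continuous_fst).const_smul (outcomeSign a : ℂ)).add
        (hu.comp continuous_snd)).const_smul (1 / 2 : ℂ)
    exact ((EuclideanSpace.proj (𝕜 := ℂ) w).continuous.comp h1).measurable
  simp only [bornProb, Matrix.mulVec, dotProduct]
  refine Complex.continuous_normSq.measurable.comp (Finset.measurable_fun_sum _ fun w _ => ?_)
  exact ((measurable_coe_apply z w).comp measurable_snd).mul ((hc w).comp measurable_fst)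

variable (P : Measure (QUnitary n)) [IsProbabilityMeasure P]
  {H : Op n} {E : Fin (2 ^ n) → ℝ} {b : OrthonormalBasis (Fin (2 ^ n)) ℂ (Ket n)}

theorem norm_krausState_le {u v : Ket n} (hu : ‖u‖ = 1) (hv : ‖v‖ = 1) (a : Bool) :
    ‖krausState u v a‖ ≤ 1 := by
  have h2 : ‖(outcomeSign a : ℂ) • u‖ = 1 := by
    rw [norm_smul, hu]; cases a <;> simp [outcomeSign]
  rw [krausState, norm_smul]
  have h1 := norm_add_le ((outcomeSign a : ℂ) • u) v
  rw [h2, hv] at h1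
  rw [show ‖(1 / 2 : ℂ)‖ = 1 / 2 by norm_num]
  linarith

/-- Expectations over one run as iterated integrals. -/
theorem integral_shotLaw (hH : IsSortedEigenbasis H E b) (ω : ℝ) {ψ : Ket n} (hψ : ‖ψ‖ = 1)
    {τ T : ℝ} (hτ : 0 < τ) (hT : 0 < T) {F : QUnitary n → Bool → Bits n → ℝ}
    (hF : ∀ a z, Continuous fun R => F R a z) {C : ℝ} (hC : ∀ R a z, |F R a z| ≤ C) :
    ∫ s, F s.2.1 s.2.2.1 s.2.2.2 ∂shotLaw P H ω τ T ψ
      = ∫ t₁, ∫ t₂, ∫ R, ∑ a, ∑ z, bornProb R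
          (krausState (evolved E b ω ψ t₁) (evolved E b ω ψ t₂) a) z * F R a z
          ∂P ∂timeLaw τ T ∂timeLaw τ T := by
  have := isProbabilityMeasure_timeLaw hτ hT
  set u := evolved E b ω ψ with hu
  have hu1 : ∀ t, ‖u t‖ = 1 := fun t => (norm_evolved ω ψ t).trans hψ
  have hmp := measurable_outcomeProb hH ω ψ
  have hmF : Measurable fun s : Shot n => F s.2.1 s.2.2.1 s.2.2.2 :=
    measurable_shot fun a z => (hF a z).measurable.comp measurable_snd
  set G : Shot n → ℝ := fun s =>
    bornProb s.2.1 (krausState (u s.1.1) (u s.1.2) s.2.2.1) s.2.2.2 * F s.2.1 s.2.2.1 s.2.2.2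
    with hG
  have hGm : Measurable G := by
    have : G = fun s => outcomeProb H ω ψ s * F s.2.1 s.2.2.1 s.2.2.2 := by
      funext s; rw [outcomeProb_eq hH]
    rw [this]; exact hmp.mul hmF
  have hGb : ∀ s, ‖G s‖ ≤ 1 * C := by
    intro s
    rw [hG, norm_mul, Real.norm_of_nonneg (bornProb_nonneg _ _ _)]
    have h1 := bornProb_le s.2.1 (krausState (u s.1.1) (u s.1.2) s.2.2.1) s.2.2.2
    have h2 := norm_krausState_le (hu1 s.1.1) (hu1 s.1.2) s.2.2.1
    refine mul_le_mul (h1.trans (pow_le_one₀ (norm_nonneg _) h2)) (hC _ _ _) (abs_nonneg _)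
      zero_le_one
  rw [shotLaw, integral_withDensity_eq_integral_toReal_smul hmp.ennreal_ofReal
    (Filter.Eventually.of_forall fun _ => ENNReal.ofReal_lt_top)]
  have hpt : ∀ s : Shot n, (ENNReal.ofReal (outcomeProb H ω ψ s)).toReal
      • F s.2.1 s.2.2.1 s.2.2.2 = G s := by
    intro s
    rw [outcomeProb_eq hH, ENNReal.toReal_ofReal (bornProb_nonneg _ _ _), smul_eq_mul]
  simp_rw [hpt]
  have hint : ∀ {α : Type} [MeasurableSpace α] (μ : Measure α) [IsFiniteMeasure μ]
      {g : α → Shot n}, Measurable g → Integrable (fun x => G (g x)) μ := by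
    intro α _ μ _ g hg
    exact Integrable.of_bound (C := 1 * C) (hGm.comp hg).aestronglyMeasurable
      (Filter.Eventually.of_forall fun x => hGb _)
  rw [integral_prod G (hint _ measurable_id)]
  have hinner : ∀ p : ℝ × ℝ, ∫ y, G (p, y) ∂(P.prod ((Measure.count : Measure Bool).prod
      (Measure.count : Measure (Bits n)))) = ∫ R, ∑ a, ∑ z, G (p, R, a, z) ∂P := by
    intro p
    rw [integral_prod _ (hint _ measurable_prodMk_left)]
    refine integral_congr_ae (Filter.Eventually.of_forall fun R => ?_)
    simp only
    rw [integral_prod (fun y : Bool × Bits n => G (p, R, y))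
      (hint _ (measurable_prodMk_left.comp measurable_prodMk_left))]
    simp only [integral_count]
  simp_rw [hinner]
  rw [integral_prod]
  have h := (hint (((timeLaw τ T).prod (timeLaw τ T)).prod
    (P.prod ((Measure.count : Measure Bool).prod (Measure.count : Measure (Bits n)))))
    measurable_id).integral_prod_left
  refine h.congr (Filter.Eventually.of_forall fun p => ?_)
  exact hinner p

/-- The law is given by a density against counting measure, so its total mass has to be computed:
the parallelogram identity handles `a`, unitarity handles `z`. -/
theorem isProbabilityMeasure_shotLaw (hH : IsSortedEigenbasis H E b) (ω : ℝ) {ψ : Ket n}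
    (hψ : ‖ψ‖ = 1) {τ T : ℝ} (hτ : 0 < τ) (hT : 0 < T) :
    IsProbabilityMeasure (shotLaw P H ω τ T ψ) := by
  have := isProbabilityMeasure_timeLaw hτ hT
  have hu1 : ∀ t, ‖evolved E b ω ψ t‖ = 1 := fun t => (norm_evolved ω ψ t).trans hψ
  have hmp := measurable_outcomeProb hH ω ψ
  have h1 := integral_shotLaw P hH ω hψ hτ hT (F := fun _ _ _ => 1) (fun _ _ => continuous_const)
    (C := 1) (by simp)
  have h2 : ∀ t₁ t₂ (R : QUnitary n), ∑ a, ∑ z, bornProb R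
      (krausState (evolved E b ω ψ t₁) (evolved E b ω ψ t₂) a) z * (1 : ℝ) = 1 := by
    intro t₁ t₂ R
    simp_rw [mul_one]
    rw [Finset.sum_comm]
    simp_rw [sum_bornProb_krausState]
    rw [← Finset.sum_div, Finset.sum_add_distrib, sum_bornProb, sum_bornProb, hu1, hu1]
    norm_num
  simp_rw [h2] at h1
  simp only [integral_const, smul_eq_mul, mul_one, probReal_univ] at h1
  refine ⟨?_⟩
  rw [measureReal_def] at h1
  have := (ENNReal.toReal_eq_one_iff _).1 h1
  exact this

end shot

/-! ### Mean and second moment of the estimator, and its bias -/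

section moments
variable {n : ℕ} {P : Measure (QUnitary n)} [IsProbabilityMeasure P]
  {H : Op n} {E : Fin (2 ^ n) → ℝ} {b : OrthonormalBasis (Fin (2 ^ n)) ℂ (Ket n)}

theorem sq_outcomeSign (a : Bool) : outcomeSign a ^ 2 = 1 := by
  cases a <;> simp [outcomeSign]

theorem abs_outcomeSign (a : Bool) : |outcomeSign a| = 1 := by
  cases a <;> simp [outcomeSign]

theorem abs_shotEstimate_le (hP : TomographicallyComplete P) (O : Op n) (s : Shot n) :
    |shotEstimate P O s| ≤ ∑ j, ∑ i, ‖shadowInverse P O i j‖ := by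
  rw [shotEstimate_eq hP, abs_mul, abs_outcomeSign, one_mul]
  exact abs_re_rotated_le _ _ _

theorem measurable_shotEstimate (hP : TomographicallyComplete P) (O : Op n) :
    Measurable (shotEstimate P O) := by
  simp_rw [funext fun s => shotEstimate_eq hP O s]
  exact measurable_shot fun a z =>
    ((continuous_re_rotated (shadowInverse P O) z).measurable.comp measurable_snd).const_mul
      (outcomeSign a)

theorem memLp_shotEstimate (hP : TomographicallyComplete P) (O : Op n) (μ : Measure (Shot n))
    [IsFiniteMeasure μ] : MemLp (shotEstimate P O) 2 μ :=
  MemLp.of_bound (measurable_shotEstimate hP O).aestronglyMeasurable _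
    (Filter.Eventually.of_forall fun s => abs_shotEstimate_le hP O s)

/-- The estimator is unbiased for the unnormalised filtered state. -/
theorem integral_shotEstimate (hP : TomographicallyComplete P) (hH : IsSortedEigenbasis H E b)
    (ω : ℝ) {ψ : Ket n} (hψ : ‖ψ‖ = 1) {τ T : ℝ} (hτ : 0 < τ) (hT : 0 < T) (O : Op n) :
    ∫ s, shotEstimate P O s ∂shotLaw P H ω τ T ψ
      = expectation O (filtered E b ω ψ τ T) := by
  have := isProbabilityMeasure_timeLaw hτ hT
  set X : QUnitary n → Bits n → ℝ := fun R z => (rotated R (shadowInverse P O) z z).re with hX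
  have h1 := integral_shotLaw P hH ω hψ hτ hT (F := fun R a z => outcomeSign a * X R z)
    (fun a z => continuous_const.mul (continuous_re_rotated _ z))
    (C := ∑ j, ∑ i, ‖shadowInverse P O i j‖) (fun R a z => by
      rw [abs_mul, abs_outcomeSign, one_mul]; exact abs_re_rotated_le _ _ _)
  simp_rw [shotEstimate_eq hP]
  rw [h1]
  -- At fixed times, unbiasedness of classical shadows reduces the integral over `R` to the
  -- polarisation identity. What remains is linear in one evolved state and conjugate-linear in the
  -- other, so the time integrals pass inside.
  have hR : ∀ u v : Ket n, ∫ R, ∑ a, ∑ z, bornProb R (krausState u v a) z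
      * (outcomeSign a * X R z) ∂P = ((inner ℂ u (Matrix.toEuclideanLin O v)).re
        + (inner ℂ v (Matrix.toEuclideanLin O u)).re) / 2 := by
    intro u v
    rw [← sum_outcomeSign_mul_expectation]
    have : ∀ R, ∑ a, ∑ z, bornProb R (krausState u v a) z * (outcomeSign a * X R z)
        = ∑ a, outcomeSign a * ∑ z, bornProb R (krausState u v a) z * X R z := fun R => by
      simp_rw [Finset.mul_sum]
      exact Finset.sum_congr rfl fun a _ => Finset.sum_congr rfl fun z _ => by ring
    simp_rw [this]
    rw [integral_finsetSum]
    · refine Finset.sum_congr rfl fun a _ => ?_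
      rw [integral_const_mul, integral_bornProb_mul_re hP]
    · intro a _
      exact (integrable_finsetSum _ fun z _ =>
        integrable_bornProb_mul_re P _ _ z).const_mul _
  simp_rw [hR]
  set u := evolved E b ω ψ with hu
  have hui : Integrable u (timeLaw τ T) := integrable_evolved ω ψ _
  let A : Ket n →L[ℂ] Ket n := Matrix.toEuclideanCLM (𝕜 := ℂ) O
  have hA : ∀ v, Matrix.toEuclideanLin O v = A v := fun v => rfl
  simp_rw [hA]
  have hAi : Integrable (fun t => A (u t)) (timeLaw τ T) := A.integrable_comp hui
  have hAint : ∫ t, A (u t) ∂timeLaw τ T = A (∫ t, u t ∂timeLaw τ T) := A.integral_comp_comm hui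
  have hright : ∀ w : Ket n, ∀ f : ℝ → Ket n, Integrable f (timeLaw τ T) →
      Integrable (fun t => (inner ℂ w (f t)).re) (timeLaw τ T) ∧
      ∫ t, (inner ℂ w (f t)).re ∂timeLaw τ T = (inner ℂ w (∫ t, f t ∂timeLaw τ T)).re := by
    intro w f hf
    refine ⟨(Complex.reCLM.integrable_comp (hf.const_inner w)), ?_⟩
    rw [← integral_inner hf]
    exact Complex.reCLM.integral_comp_comm (hf.const_inner w)
  have hleft : ∀ w : Ket n, ∀ f : ℝ → Ket n, Integrable f (timeLaw τ T) →
      Integrable (fun t => (inner ℂ (f t) w).re) (timeLaw τ T) ∧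
      ∫ t, (inner ℂ (f t) w).re ∂timeLaw τ T = (inner ℂ (∫ t, f t ∂timeLaw τ T) w).re := by
    intro w f hf
    have hs : ∀ x : Ket n, (inner ℂ x w).re = (inner ℂ w x).re := fun x =>
      inner_re_symm (𝕜 := ℂ) x w
    simp_rw [hs]
    exact hright w f hf
  have hin : ∀ t₁, ∫ t₂, ((inner ℂ (u t₁) (A (u t₂))).re + (inner ℂ (u t₂) (A (u t₁))).re) / 2
      ∂timeLaw τ T = ((inner ℂ (u t₁) (A (∫ t, u t ∂timeLaw τ T))).re
        + (inner ℂ (∫ t, u t ∂timeLaw τ T) (A (u t₁))).re) / 2 := by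
    intro t₁
    rw [integral_div, integral_add (hright _ _ hAi).1 (hleft _ _ hui).1, (hright _ _ hAi).2,
      (hleft _ _ hui).2, hAint]
  simp_rw [hin]
  rw [integral_div, integral_add (hleft _ _ hui).1 (hright _ _ hAi).1, (hright _ _ hAi).2,
      (hleft _ _ hui).2, hAint, expectation, filtered, hA]
  ring

theorem integral_shotEstimate_sq_eq (hP : TomographicallyComplete P)
    (hH : IsSortedEigenbasis H E b)
    (ω : ℝ) {ψ : Ket n} (hψ : ‖ψ‖ = 1) {τ T : ℝ} (hτ : 0 < τ) (hT : 0 < T) (O : Op n) :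
    ∫ s, shotEstimate P O s ^ 2 ∂shotLaw P H ω τ T ψ
      = ∫ t₁, ∫ t₂, ((∫ R, ∑ z, bornProb R (evolved E b ω ψ t₁) z
            * (rotated R (shadowInverse P O) z z).re ^ 2 ∂P)
          + ∫ R, ∑ z, bornProb R (evolved E b ω ψ t₂) z
            * (rotated R (shadowInverse P O) z z).re ^ 2 ∂P) / 2 ∂timeLaw τ T ∂timeLaw τ T := by
  set X : QUnitary n → Bits n → ℝ := fun R z => (rotated R (shadowInverse P O) z z).re with hX
  have h1 := integral_shotLaw P hH ω hψ hτ hT (F := fun R _ z => X R z ^ 2)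
    (fun a z => (continuous_re_rotated _ z).pow 2)
    (C := (∑ j, ∑ i, ‖shadowInverse P O i j‖) ^ 2) (fun R a z => by
      rw [abs_of_nonneg (sq_nonneg _)]; exact re_rotated_sq_le _ _ _)
  simp_rw [shotEstimate_eq hP, mul_pow, sq_outcomeSign, one_mul]
  rw [h1]
  have hi : ∀ w : Ket n, Integrable (fun R => ∑ z, bornProb R w z * X R z ^ 2) P := fun w =>
    integrable_finsetSum _ fun z _ => integrable_bornProb_mul_re_sq P w _ z
  refine integral_congr_ae (Filter.Eventually.of_forall fun t₁ =>
    integral_congr_ae (Filter.Eventually.of_forall fun t₂ => ?_))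
  simp only
  rw [← integral_add (hi _) (hi _), ← integral_div]
  refine integral_congr_ae (Filter.Eventually.of_forall fun R => ?_)
  simp only
  rw [Finset.sum_comm, ← Finset.sum_add_distrib, Finset.sum_div]
  refine Finset.sum_congr rfl fun z _ => ?_
  rw [← Finset.sum_mul, sum_bornProb_krausState]
  ring

theorem integral_shotEstimate_sq_le (hP : TomographicallyComplete P)
    (hH : IsSortedEigenbasis H E b)
    (ω : ℝ) {ψ : Ket n} (hψ : ‖ψ‖ = 1) {τ T : ℝ} (hτ : 0 < τ) (hT : 0 < T) (O : Op n) :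
    ∫ s, shotEstimate P O s ^ 2 ∂shotLaw P H ω τ T ψ ≤ shadowNorm P O ^ 2 := by
  have := isProbabilityMeasure_timeLaw hτ hT
  rw [integral_shotEstimate_sq_eq hP hH ω hψ hτ hT]
  set q : ℝ → ℝ := fun t => ∫ R, ∑ z, bornProb R (evolved E b ω ψ t) z
            * (rotated R (shadowInverse P O) z z).re ^ 2 ∂P with hq
  have hq0 : ∀ t, 0 ≤ q t := fun t => integral_nonneg fun R => Finset.sum_nonneg fun z _ =>
    mul_nonneg (bornProb_nonneg _ _ _) (sq_nonneg _)
  have hq1 : ∀ t, q t ≤ shadowNorm P O ^ 2 := fun t =>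
    integral_bornProb_mul_re_sq_le O ((norm_evolved ω ψ t).trans hψ)
  have hin0 : ∀ t₁, 0 ≤ ∫ t₂, (q t₁ + q t₂) / 2 ∂timeLaw τ T := fun t₁ =>
    integral_nonneg fun t₂ => by
      change 0 ≤ (q t₁ + q t₂) / 2
      linarith [hq0 t₁, hq0 t₂]
  have hin : ∀ t₁, ∫ t₂, (q t₁ + q t₂) / 2 ∂timeLaw τ T ≤ shadowNorm P O ^ 2 := fun t₁ => by
    -- Only the dominating constant must be integrable, so measurability of `q` is not needed.
    refine (integral_mono_of_nonneg (g := fun _ => shadowNorm P O ^ 2)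
      (Filter.Eventually.of_forall fun t₂ => ?_)
      (integrable_const _) (Filter.Eventually.of_forall fun t₂ => ?_)).trans_eq (by simp)
    · change 0 ≤ (q t₁ + q t₂) / 2
      linarith [hq0 t₁, hq0 t₂]
    · change (q t₁ + q t₂) / 2 ≤ _
      linarith [hq1 t₁, hq1 t₂]
  exact (integral_mono_of_nonneg (g := fun _ => shadowNorm P O ^ 2)
    (Filter.Eventually.of_forall hin0) (integrable_const _)
    (Filter.Eventually.of_forall hin)).trans_eq (by simp)

/-- As `ℳ⁻¹(1) = 1`, the estimate of the identity is just the ancilla sign. -/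
theorem integral_shotEstimate_one_sq (hP : TomographicallyComplete P)
    (hH : IsSortedEigenbasis H E b)
    (ω : ℝ) {ψ : Ket n} (hψ : ‖ψ‖ = 1) {τ T : ℝ} (hτ : 0 < τ) (hT : 0 < T) :
    ∫ s, shotEstimate P 1 s ^ 2 ∂shotLaw P H ω τ T ψ ≤ 1 := by
  have := isProbabilityMeasure_shotLaw P hH ω hψ hτ hT
  have h : ∀ s : Shot n, shotEstimate P 1 s ^ 2 = 1 := fun s => by
    rw [shotEstimate_eq hP, shadowInverse_one hP, rotated_one, mul_pow, sq_outcomeSign]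
    simp
  simp [h]

end moments

section bias
variable {n : ℕ}

/-- Two cross terms and one quadratic term in `r` remain, each at most `B * e`. -/
theorem abs_expectation_add_sub_le {O : Op n} {B : ℝ}
    (hO : ‖Matrix.toEuclideanCLM (𝕜 := ℂ) O‖ ≤ B) {φ r : Ket n} {c : ℂ} (hφ : ‖φ‖ = 1)
    (hc : ‖c‖ ≤ 1) {e : ℝ} (hr : ‖r‖ ≤ e) (he : e ≤ 1) :
    |expectation O (c • φ + r) - ‖c‖ ^ 2 * expectation O φ| ≤ 3 * (B * e) := by
  set A := Matrix.toEuclideanCLM (𝕜 := ℂ) O with hA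
  have hAl : ∀ v, Matrix.toEuclideanLin O v = A v := fun v => rfl
  have hB : 0 ≤ B := (norm_nonneg _).trans hO
  have hb : ∀ u v : Ket n, |(inner ℂ u (A v)).re| ≤ B * (‖u‖ * ‖v‖) := fun u v => by
    calc _ ≤ ‖(inner ℂ u (A v) : ℂ)‖ := Complex.abs_re_le_norm _
      _ ≤ ‖u‖ * ‖A v‖ := norm_inner_le_norm _ _
      _ ≤ ‖u‖ * (B * ‖v‖) := by gcongr; exact A.le_of_opNorm_le hO v
      _ = _ := by ring
  have hφc : ‖c • φ‖ ≤ 1 := by rw [norm_smul, hφ, mul_one]; exact hc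
  have he0 : 0 ≤ e := (norm_nonneg _).trans hr
  have hcc : (inner ℂ (c • φ) (A (c • φ))).re = ‖c‖ ^ 2 * (inner ℂ φ (A φ)).re := by
    rw [map_smul, inner_smul_left, inner_smul_right, ← mul_assoc, Complex.conj_mul',
      ← Complex.ofReal_pow, Complex.re_ofReal_mul]
  have h1 : expectation O (c • φ + r) - ‖c‖ ^ 2 * expectation O φ
      = (inner ℂ (c • φ) (A r)).re + (inner ℂ r (A (c • φ))).re + (inner ℂ r (A r)).re := by
    rw [expectation, expectation, hAl, hAl, ← hcc, map_add, inner_add_left, inner_add_right,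
      inner_add_right]
    simp only [Complex.add_re]
    ring
  have k1 : B * (‖c • φ‖ * ‖r‖) ≤ B * e := by
    gcongr; exact (mul_le_of_le_one_left (norm_nonneg _) hφc).trans hr
  have k2 : B * (‖r‖ * ‖c • φ‖) ≤ B * e := by rw [mul_comm ‖r‖]; exact k1
  have k3 : B * (‖r‖ * ‖r‖) ≤ B * e := by
    gcongr; exact (mul_le_of_le_one_left (norm_nonneg _) (hr.trans he)).trans hr
  rw [h1]
  refine (abs_add_three _ _ _).trans ?_
  linarith [hb (c • φ) r, hb r (c • φ), hb r r]

theorem expectation_one (v : Ket n) : expectation 1 v = ‖v‖ ^ 2 := by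
  rw [expectation]
  have : Matrix.toEuclideanLin (1 : Op n) v = v := by
    apply WithLp.ofLp_injective
    rw [ofLp_toEuclideanLin, Matrix.one_mulVec]
  rw [this]
  exact inner_self_eq_norm_sq (𝕜 := ℂ) v

/-- By orthogonality the leakage can only raise the denominator, and only to second order. -/
theorem expectation_one_add {φ r : Ket n} {c : ℂ} (hφ : ‖φ‖ = 1)
    (hr : inner ℂ φ r = (0 : ℂ)) : expectation 1 (c • φ + r) = ‖c‖ ^ 2 + ‖r‖ ^ 2 := by
  rw [expectation_one, sq, norm_add_sq_eq_norm_sq_add_norm_sq_of_inner_eq_zero (𝕜 := ℂ),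
    norm_smul, hφ]
  · ring
  · rw [inner_smul_left, hr, mul_zero]

theorem abs_expectation_le {O : Op n} {B : ℝ}
    (hO : ‖Matrix.toEuclideanCLM (𝕜 := ℂ) O‖ ≤ B) {φ : Ket n} (hφ : ‖φ‖ = 1) :
    |expectation O φ| ≤ B := by
  set A := Matrix.toEuclideanCLM (𝕜 := ℂ) O with hA
  calc |expectation O φ| ≤ ‖(inner ℂ φ (A φ) : ℂ)‖ := Complex.abs_re_le_norm _
    _ ≤ ‖φ‖ * ‖A φ‖ := norm_inner_le_norm _ _
    _ ≤ ‖φ‖ * (B * ‖φ‖) := by gcongr; exact A.le_of_opNorm_le hO φ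
    _ = B := by rw [hφ]; ring

end bias

/-! ### Choice of parameters -/

theorem one_half_le_log_two : (1 / 2 : ℝ) ≤ Real.log 2 := by
  linarith [Real.log_two_gt_d9]

/-- The choices `τ = √ℓ/Δ` and `T = 2ℓ/Δ` make both exponents equal to `-ℓ`, so the error is `6
e^{-ℓ}`; since `144 = 6 * 24`, it meets the target with equality. -/
theorem exists_evolution_times {η B' : ℝ} (hη : 0 < η) (hη1 : η ≤ 1) (hB : 1 ≤ B') :
    ∃ CT : ℝ, 0 < CT ∧ ∀ ε : ℝ, 0 < ε → ε ≤ 1 / 2 → ∀ Δ : ℝ, 0 < Δ → ∃ τ T : ℝ,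
      0 < τ ∧ 0 < T ∧ T ≤ CT * (Δ⁻¹ * Real.log ε⁻¹) ∧
      2 * Real.exp (-T ^ 2 / (4 * τ ^ 2)) ≤ 1 / 2 ∧
      2 * (Real.exp (-(τ ^ 2 * Δ ^ 2)) + 2 * Real.exp (-T ^ 2 / (4 * τ ^ 2)))
        ≤ η * ε / (24 * B') := by
  have hA1 : 1 ≤ 144 * B' / η := by rw [le_div_iff₀ hη]; linarith
  have hlogA : 0 ≤ Real.log (144 * B' / η) := Real.log_nonneg hA1
  have hl2 := one_half_le_log_two
  refine ⟨2 * (2 * Real.log (144 * B' / η) + 1), by positivity, ?_⟩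
  intro ε hε hε2 Δ hΔ
  have hx : Real.log 2 ≤ Real.log ε⁻¹ := by
    apply Real.log_le_log (by norm_num)
    rw [le_inv_comm₀ (by norm_num) hε]; linarith
  set ℓ := Real.log (144 * B' / η) + Real.log ε⁻¹ with hℓ
  have hℓ0 : 0 < ℓ := by linarith
  have hexp : Real.exp (-ℓ) = η * ε / (144 * B') := by
    rw [hℓ, ← Real.log_mul (by positivity) (by positivity), Real.exp_neg,
      Real.exp_log (by positivity)]
    field_simp
  have hτ2 : (√ℓ / Δ) ^ 2 = ℓ / Δ ^ 2 := by rw [div_pow, Real.sq_sqrt hℓ0.le]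
  have e1 : -(2 * ℓ / Δ) ^ 2 / (4 * (√ℓ / Δ) ^ 2) = -ℓ := by
    rw [hτ2]; field_simp; norm_num
  have e2 : -((√ℓ / Δ) ^ 2 * Δ ^ 2) = -ℓ := by
    rw [hτ2]; field_simp
  have hsq : 0 < √ℓ := Real.sqrt_pos.2 hℓ0
  refine ⟨√ℓ / Δ, 2 * ℓ / Δ, by positivity, by positivity, ?_, ?_, ?_⟩
  -- Since `ε ≤ 1/2`, `log ε⁻¹ ≥ 1/2`, which absorbs the additive constant into a factor.
  · have : ℓ ≤ (2 * Real.log (144 * B' / η) + 1) * Real.log ε⁻¹ := by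
      rw [hℓ]; nlinarith
    calc 2 * ℓ / Δ = 2 * (Δ⁻¹ * ℓ) := by field_simp
      _ ≤ 2 * (Δ⁻¹ * ((2 * Real.log (144 * B' / η) + 1) * Real.log ε⁻¹)) := by gcongr
      _ = _ := by ring
  · rw [e1, hexp]
    have : η * ε / (144 * B') ≤ 1 / 4 := by
      rw [div_le_iff₀ (by positivity)]; nlinarith
    linarith
  · rw [e1, e2, hexp]
    apply le_of_eq
    field_simp
    norm_num

/-- The two conditions on `L` are the same condition, met because `1024 = 16 * 8²`. The assumptions
`ε < s` and `δ ≤ 1/2` keep `s²/ε²` and `log(M/δ)` away from 0, so rounding up costs only constant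
factors. -/
theorem exists_sample_sizes {η : ℝ} (hη : 0 < η) {ε δ s : ℝ} (hε : 0 < ε) (hs : ε < s)
    (hδ : 0 < δ) (hδ2 : δ ≤ 1 / 2) {M : ℕ} (hM : 0 < M) :
    ∃ K L : ℕ, ((K * L : ℕ) : ℝ)
        ≤ 6 * (1024 / η ^ 2 + 1) * (ε⁻¹ ^ 2 * s ^ 2 * Real.log (M / δ)) ∧
      0 < L ∧ 16 * s ^ 2 ≤ L * (η * ε / 8) ^ 2 ∧ 16 * 1 ≤ L * (η * ε / (8 * s)) ^ 2 ∧
      (M + 1) * (2⁻¹ : ℝ) ^ K ≤ δ := by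
  have hM' : (1 : ℝ) ≤ M := by exact_mod_cast hM
  have hs0 : 0 < s := hε.trans hs
  have hl2 := one_half_le_log_two
  have hMδ : 2 ≤ M / δ := by rw [le_div_iff₀ hδ]; linarith
  set x := Real.log (M / δ) with hx
  have hxl : Real.log 2 ≤ x := Real.log_le_log (by norm_num) hMδ
  have hr : 1 ≤ ε⁻¹ ^ 2 * s ^ 2 := by
    rw [← mul_pow]
    apply one_le_pow₀
    rw [inv_mul_eq_div, le_div_iff₀ hε]; linarith
  set y := 1024 / η ^ 2 * (ε⁻¹ ^ 2 * s ^ 2) with hy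
  have hy0 : 0 < y := by positivity
  have hK := Nat.le_ceil (4 * x)
  have hK' := (Nat.ceil_lt_add_one (by linarith : 0 ≤ 4 * x)).le
  have hL := Nat.le_ceil y
  have hL' := (Nat.ceil_lt_add_one hy0.le).le
  set K := ⌈4 * x⌉₊
  set L := ⌈y⌉₊
  refine ⟨K, L, ?_, Nat.ceil_pos.2 hy0, ?_, ?_, ?_⟩
  · push_cast
    have h1 : (K : ℝ) ≤ 6 * x := by linarith
    have h2 : (L : ℝ) ≤ (1024 / η ^ 2 + 1) * (ε⁻¹ ^ 2 * s ^ 2) := by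
      rw [add_mul, one_mul]; linarith
    calc (K : ℝ) * L ≤ (6 * x) * ((1024 / η ^ 2 + 1) * (ε⁻¹ ^ 2 * s ^ 2)) := by
          apply mul_le_mul h1 h2 (by positivity) (by linarith)
      _ = _ := by ring
  · calc 16 * s ^ 2 = y * (η * ε / 8) ^ 2 := by rw [hy]; field_simp; norm_num
      _ ≤ _ := by gcongr
  · calc 16 * 1 = y * (η * ε / (8 * s)) ^ 2 := by rw [hy]; field_simp; norm_num
      _ ≤ _ := by gcongr
  -- From `e^{1/2} ≤ 2` and `K ≥ 4 log(M/δ)` follows `2 ^ K ≥ (M/δ)² ≥ 2M/δ`, enough for `M + 1` bad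
  -- events.
  · have h2 : Real.exp (1 / 2) ≤ 2 := by
      calc Real.exp (1 / 2) ≤ Real.exp (Real.log 2) := Real.exp_le_exp.2 hl2
        _ = 2 := Real.exp_log (by norm_num)
    have h3 : (M / δ) ^ 2 ≤ (2 : ℝ) ^ K := by
      calc (M / δ) ^ 2 = Real.exp (2 * x) := by
            rw [hx, mul_comm, Real.exp_mul, Real.exp_log (by positivity)]; norm_num
        _ ≤ Real.exp (K * (1 / 2)) := Real.exp_le_exp.2 (by linarith)
        _ = Real.exp (1 / 2) ^ K := Real.exp_nat_mul _ _
        _ ≤ 2 ^ K := by gcongr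
    have h4 : 2 * (M / δ) ≤ (2 : ℝ) ^ K := by nlinarith
    rw [inv_pow, ← div_eq_mul_inv, div_le_iff₀ (by positivity)]
    calc (M : ℝ) + 1 ≤ 2 * M := by linarith
      _ = δ * (2 * (M / δ)) := by field_simp
      _ ≤ _ := by gcongr

/-- Error propagation for the quotient of the two estimates. -/
theorem abs_div_sub_le {η ε s B' p ρ e A a D o : ℝ} (hη : 0 < η) (hη1 : η ≤ 1) (hε : 0 < ε)
    (hε2 : ε ≤ 1 / 2) (hs : ε < s) (hB : 1 ≤ B') (hp : η ≤ p) (hρ : 0 ≤ ρ) (hρe : ρ ≤ e ^ 2)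
    (he0 : 0 ≤ e) (he : e ≤ η * ε / (24 * B')) (hos : |o| ≤ s) (hoB : |o| ≤ B')
    (hD : |D - (p + ρ)| < η * ε / (8 * s)) (hA : |A - a| < η * ε / 8)
    (ha : |a - p * o| ≤ 3 * (B' * e)) : |A / D - o| ≤ ε := by
  have hs0 : 0 < s := hε.trans hs
  have hBe : B' * e ≤ η * ε / 24 := by
    calc B' * e ≤ B' * (η * ε / (24 * B')) := by gcongr
      _ = _ := by field_simp
  have he1 : e ≤ 1 := by nlinarith
  have hρ' : |o| * ρ ≤ η * ε / 24 := by
    calc |o| * ρ ≤ B' * e := by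
          gcongr
          exact hρe.trans (by nlinarith)
      _ ≤ _ := hBe
  have hoD : |o| * |D - (p + ρ)| ≤ η * ε / 8 := by
    calc |o| * |D - (p + ρ)| ≤ s * (η * ε / (8 * s)) := by gcongr
      _ = _ := by field_simp
  have hc0 : η * ε / (8 * s) ≤ η / 8 := by
    rw [div_le_div_iff₀ (by positivity) (by norm_num)]
    nlinarith
  have hDlow : η / 2 ≤ D := by
    have := (abs_lt.1 hD).1
    linarith
  have hD0 : 0 < D := by linarith
  -- The four contributions are at most `ηε` times 1/8, 1/8, 1/8 and 1/24, together below `ηε/2`,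
  -- while `D ≥ η/2`. The bound `|o| ≤ s` serves the fluctuation of `D`, and `|o| ≤ B'` serves its
  -- bias `ρ`.
  have hid : A - o * D = (A - a) + (a - p * o) + (-(o * (D - (p + ρ))) - o * ρ) := by ring
  have hmain : |A - o * D| ≤ η / 2 * ε := by
    rw [hid]
    refine (abs_add_three _ _ _).trans ?_
    have h1 : |-(o * (D - (p + ρ))) - o * ρ| ≤ |o| * |D - (p + ρ)| + |o| * ρ := by
      refine (abs_sub _ _).trans_eq ?_
      rw [abs_neg, abs_mul, abs_mul, abs_of_nonneg hρ]
    nlinarith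
  have : A / D - o = (A - o * D) / D := by field_simp
  rw [this, abs_div, abs_of_pos hD0, div_le_iff₀ hD0]
  nlinarith

/-! ### Union bound and assembly of the guarantee. -/

theorem ofReal_one_sub_le {Ω ι : Type*} [MeasurableSpace Ω] [Fintype ι] {μ : Measure Ω}
    [IsProbabilityMeasure μ] {S : Set Ω} (bad : ι → Set Ω) (hS : ∀ x, (∀ i, x ∉ bad i) → x ∈ S)
    {δ β : ℝ} (hδ : 0 ≤ δ) (hbad : ∀ i, μ (bad i) ≤ ENNReal.ofReal β)
    (hsum : Fintype.card ι * β ≤ δ) : ENNReal.ofReal (1 - δ) ≤ μ S := by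
  -- Covering the whole space instead of taking complements avoids any measurability of `S` or of
  -- the bad events.
  have h1 : Set.univ ⊆ S ∪ ⋃ i, bad i := by
    intro x _
    by_cases hx : ∃ i, x ∈ bad i
    · exact Or.inr (Set.mem_iUnion.2 hx)
    · exact Or.inl (hS x fun i hi => hx ⟨i, hi⟩)
  have h2 : μ (⋃ i, bad i) ≤ ENNReal.ofReal δ := by
    calc μ (⋃ i, bad i) ≤ ∑ i, μ (bad i) := measure_iUnion_fintype_le _ _
      _ ≤ ∑ _i : ι, ENNReal.ofReal β := Finset.sum_le_sum fun i _ => hbad i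
      _ = ENNReal.ofReal (Fintype.card ι * β) := by
          rw [Finset.sum_const, nsmul_eq_mul, ENNReal.ofReal_mul (by positivity)]
          simp
      _ ≤ _ := ENNReal.ofReal_le_ofReal hsum
  have h3 : 1 ≤ μ S + ENNReal.ofReal δ := by
    calc 1 = μ Set.univ := measure_univ.symm
      _ ≤ μ (S ∪ ⋃ i, bad i) := measure_mono h1
      _ ≤ μ S + μ (⋃ i, bad i) := measure_union_le _ _
      _ ≤ _ := by gcongr
  rw [ENNReal.ofReal_sub _ hδ, ENNReal.ofReal_one]
  exact tsub_le_iff_right.2 h3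

theorem eigenstateEstimate_of_isEmpty {n L : ℕ} (P : Measure (QUnitary n)) (O : Op n)
    (data : Fin 0 × Fin L → Shot n) : eigenstateEstimate P O data = 0 := by
  simp [eigenstateEstimate, medianOfMeans, median]

theorem ofReal_one_sub_le_measure_eigenstateEstimate {η : ℝ} (hη : 0 < η) (hη1 : η ≤ 1) {B B' : ℝ} (hBB : B ≤ B')
    (hB' : 1 ≤ B') {n : ℕ} {P : Measure (QUnitary n)} [IsProbabilityMeasure P]
    (hP : TomographicallyComplete P) {M : ℕ} {O : Fin M → Op n}
    (hO : ∀ m, ‖Matrix.toEuclideanCLM (𝕜 := ℂ) (O m)‖ ≤ B) {ε δ s : ℝ} (hε : 0 < ε)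
    (hε2 : ε ≤ 1 / 2) (hδ : 0 < δ) (hs : ε < s) (hOs : ∀ m, shadowNorm P (O m) ≤ s) {K L : ℕ}
    (hL0 : 0 < L) (hL1 : 16 * s ^ 2 ≤ L * (η * ε / 8) ^ 2)
    (hL2 : 16 * 1 ≤ L * (η * ε / (8 * s)) ^ 2) (hK : (M + 1) * (2⁻¹ : ℝ) ^ K ≤ δ)
    {H : Op n} {E : Fin (2 ^ n) → ℝ} {b : OrthonormalBasis (Fin (2 ^ n)) ℂ (Ket n)}
    (hH : IsSortedEigenbasis H E b) (j : Fin (2 ^ n)) (hΔ : 0 < energyGap E j) {ψ : Ket n}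
    (hψ : ‖ψ‖ = 1) (hp : η ≤ ‖(inner ℂ (b j) ψ : ℂ)‖ ^ 2) {τ T : ℝ} (hτ : 0 < τ) (hT : 0 < T)
    (hq : 2 * Real.exp (-T ^ 2 / (4 * τ ^ 2)) ≤ 1 / 2)
    (he : 2 * (Real.exp (-(τ ^ 2 * energyGap E j ^ 2)) + 2 * Real.exp (-T ^ 2 / (4 * τ ^ 2)))
        ≤ η * ε / (24 * B')) :
    ENNReal.ofReal (1 - δ) ≤
      Measure.pi (fun _ : Fin K × Fin L => shotLaw P H (E j) τ T ψ)
        {data | ∀ m, |eigenstateEstimate P (O m) data - expectation (O m) (b j)| ≤ ε} := by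
  have hs0 : 0 < s := hε.trans hs
  have := isProbabilityMeasure_shotLaw P hH (E j) hψ hτ hT
  obtain ⟨r, hr1, hr2, hr3⟩ := exists_filtered_eq (b := b) hH.sorted j ψ hψ hτ hT hΔ hq he
  set e := η * ε / (24 * B') with he_def
  have he0 : 0 ≤ e := by positivity
  have he1 : e ≤ 1 := by
    rw [he_def, div_le_iff₀ (by positivity)]; nlinarith
  have hφ : ‖b j‖ = 1 := b.norm_eq_one j
  have hc1 : ‖(inner ℂ (b j) ψ : ℂ)‖ ≤ 1 := by
    simpa [hφ, hψ] using norm_inner_le_norm (𝕜 := ℂ) (b j) ψ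
  set c : ℂ := inner ℂ (b j) ψ with hc
  set μ := shotLaw P H (E j) τ T ψ with hμ
  -- `none` is the failure of the common denominator, `some m` that of the `m`-th numerator. They
  -- share their data, but the union bound needs no independence.
  set bad : Option (Fin M) → Set (Fin K × Fin L → Shot n) := fun i => i.elim
    {data | η * ε / (8 * s) ≤ |medianOfMeans P 1 data - ∫ ω, shotEstimate P 1 ω ∂μ|}
    (fun m => {data | η * ε / 8 ≤
      |medianOfMeans P (O m) data - ∫ ω, shotEstimate P (O m) ω ∂μ|}) with hbad
  refine ofReal_one_sub_le bad ?_ (β := 2⁻¹ ^ K) hδ.le ?_ ?_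
  · intro data hdata m
    have hm := hdata (some m)
    have h1 := hdata none
    simp only [hbad, Option.elim, Set.mem_ofPred_eq, not_le] at hm h1
    rw [integral_shotEstimate hP hH (E j) hψ hτ hT, hr1] at hm h1
    rw [expectation_one_add hφ hr2] at h1
    exact abs_div_sub_le hη hη1 hε hε2 hs hB' hp (sq_nonneg ‖r‖)
      (pow_le_pow_left₀ (norm_nonneg _) hr3 2) he0 le_rfl
      ((abs_expectation_le_shadowNorm hP (O m) hφ).trans (hOs m))
      (abs_expectation_le ((hO m).trans hBB) hφ) h1 hm
      (abs_expectation_add_sub_le ((hO m).trans hBB) hφ hc1 hr3 he1)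
  · have hβ : ENNReal.ofReal (2⁻¹ ^ K) = (2⁻¹ : ℝ≥0∞) ^ K := by
      rw [ENNReal.ofReal_pow (by norm_num), ENNReal.ofReal_inv_of_pos (by norm_num)]; simp
    rw [hβ]
    rintro (_ | m)
    · exact measure_medianOfMeans_dev_le μ (measurable_shotEstimate hP 1)
        (memLp_shotEstimate hP 1 μ) (by positivity)
        (integral_shotEstimate_one_sq hP hH (E j) hψ hτ hT) hL0 hL2
    · refine measure_medianOfMeans_dev_le μ (measurable_shotEstimate hP (O m))
        (memLp_shotEstimate hP (O m) μ) (by positivity)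
        ((integral_shotEstimate_sq_le hP hH (E j) hψ hτ hT (O m)).trans ?_) hL0 hL1
      exact pow_le_pow_left₀ (Real.sqrt_nonneg _) (hOs m) 2
  · simpa using hK

theorem mainTheorem5 (η : ℝ) (hη : 0 < η) :
    ∃ CN : ℝ, 0 < CN ∧ ∀ B : ℝ, 0 < B → ∃ CT : ℝ, 0 < CT ∧
      ∀ (n : ℕ) (P : MeasureTheory.Measure (QUnitary n)),
        MeasureTheory.IsProbabilityMeasure P → TomographicallyComplete P →
      ∀ (M : ℕ) (O : Fin M → Op n), 0 < M →
        (∀ m, (O m).IsHermitian) → (∀ m, ‖Matrix.toEuclideanCLM (𝕜 := ℂ) (O m)‖ ≤ B) →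
      ∀ ε δ : ℝ, 0 < ε → ε ≤ 1 / 2 → 0 < δ → δ ≤ 1 / 2 →
      -- the number `K * L` of measurements
      ∃ K L : ℕ,
        ((K * L : ℕ) : ℝ) ≤ CN * (ε⁻¹ ^ 2 * (⨆ m, shadowNorm P (O m)) ^ 2 * Real.log (M / δ)) ∧
      ∀ Δ : ℝ, 0 < Δ →
      -- the filter width `τ` and the maximum evolution time `T`
      ∃ τ T : ℝ, 0 < τ ∧ 0 < T ∧ T ≤ CT * (Δ⁻¹ * Real.log ε⁻¹) ∧
      ∀ (H : Op n) (E : Fin (2 ^ n) → ℝ) (b : OrthonormalBasis (Fin (2 ^ n)) ℂ (Ket n)),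
        IsSortedEigenbasis H E b →
      ∀ j : Fin (2 ^ n), energyGap E j = Δ →
      ∀ ψ : Ket n, ‖ψ‖ = 1 → η ≤ ‖(inner ℂ (b j) ψ : ℂ)‖ ^ 2 →
        ENNReal.ofReal (1 - δ) ≤
          MeasureTheory.Measure.pi (fun _ : Fin K × Fin L => shotLaw P H (E j) τ T ψ)
            {data | ∀ m, |eigenstateEstimate P (O m) data - expectation (O m) (b j)| ≤ ε} := by
  -- Constants are required for every `η > 0`, although no overlap exceeds 1. Passing to `min η 1`,
  -- and to `max B 1` for the norm bound, weakens the assumptions on the data and gives the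
  -- normalisation used in the estimates.
  have hη' : 0 < min η 1 := lt_min hη one_pos
  refine ⟨6 * (1024 / min η 1 ^ 2 + 1), by positivity, fun B _ => ?_⟩
  obtain ⟨CT, hCT, hCT'⟩ := exists_evolution_times hη' (min_le_right η 1) (le_max_right B 1)
  refine ⟨CT, hCT, fun n P hPp hP M O hM _ hO ε δ hε hε2 hδ hδ2 => ?_⟩
  set s := ⨆ m, shadowNorm P (O m) with hs
  have hOs : ∀ m, shadowNorm P (O m) ≤ s := fun m =>
    le_ciSup (f := fun m => shadowNorm P (O m)) (Set.finite_range _).bddAbove m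
  -- For `s ≤ ε` no measurement is made and the estimate is 0; the error is `|⟨O⟩| ≤ s ≤ ε`.
  rcases le_or_gt s ε with hsε | hsε
  · refine ⟨0, 0, ?_, fun Δ hΔ => ?_⟩
    · have hM' : (1 : ℝ) ≤ M := by exact_mod_cast hM
      have : 0 ≤ Real.log (M / δ) := Real.log_nonneg (by rw [le_div_iff₀ hδ]; linarith)
      simp only [Nat.zero_mul, Nat.cast_zero]
      positivity
    · obtain ⟨τ, T, hτ, hT, hTle, -, -⟩ := hCT' ε hε hε2 Δ hΔ
      refine ⟨τ, T, hτ, hT, hTle, fun H E b hH j _ ψ hψ _ => ?_⟩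
      have := isProbabilityMeasure_shotLaw P hH (E j) hψ hτ hT
      have huniv : {data : Fin 0 × Fin 0 → Shot n | ∀ m,
          |eigenstateEstimate P (O m) data - expectation (O m) (b j)| ≤ ε} = Set.univ := by
        refine Set.eq_univ_of_forall fun data m => ?_
        rw [eigenstateEstimate_of_isEmpty, zero_sub, abs_neg]
        exact ((abs_expectation_le_shadowNorm hP (O m) (b.norm_eq_one j)).trans (hOs m)).trans hsε
      rw [huniv, measure_univ]
      exact ENNReal.ofReal_le_one.2 (by linarith)
  · obtain ⟨K, L, hKL, hL0, hL1, hL2, hK⟩ := exists_sample_sizes hη' hε hsε hδ hδ2 hM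
    refine ⟨K, L, hKL, fun Δ hΔ => ?_⟩
    obtain ⟨τ, T, hτ, hT, hTle, hq, he⟩ := hCT' ε hε hε2 Δ hΔ
    refine ⟨τ, T, hτ, hT, hTle, fun H E b hH j hj ψ hψ hp => ?_⟩
    subst hj
    exact ofReal_one_sub_le_measure_eigenstateEstimate hη' (min_le_right η 1) (le_max_left B 1) (le_max_right B 1) hP hO hε hε2
      hδ hsε hOs hL0 hL1 hL2 hK hH j hΔ hψ ((min_le_left η 1).trans hp) hτ hT hq he
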